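/- **Setting.** A binary tree is a finite set $T$ of finite words over $\{0,1\}$ such that $(u_1,\dots,u_k)\in T$, $k\ge 1$, implies $(u_1,\dots,u_{k-1})\in T$. For $s\in[0,1]$ let $0.u_1u_2\dots$ be its binary expansion (ending in zeros if $s<1$ is a binary rational, and $u_k=1$ for all $k$ if $s=1$), and let $X_s(T):=\min\{k\ge 0:(u_1,\dots,u_k)\notin T\}$ be the silhouette of $T$. Put $Y_t(T):=\int_0^t X_s(T)\,ds$, $Y^\circ_t(T):=Y_t(T)-tY_1(T)$ for $0\le t\le 1$, $\eta(T):=Y_1(T)=\int_0^1X_s(T)\,ds$ and $\eta^\circ(T):=\eta(T)-H(\#T)$, where $H(n)=\sum_{k=1}^n 1/k$. Let $\xi_1,\xi_2,\dots$ be independent random variables, uniformly distributed on $[0,1]$, and let $T_n$ be the (unlabeled) binary search tree generated from $\xi_1,\dots,\xi_n$, inserted in this order: a new value starts at the root and moves to the left (letter $0$) if it is smaller than the label of the current node and to the right (letter $1$) otherwise, until it finds an empty place, where it is stored. Let $C_{00}[0,1]$ be the space of continuous $f:[0,1]\to\mathbb R$ with $f(0)=f(1)=0$, let $S:=C_{00}[0,1]\times\mathbb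 R$, a separable Banach space with the norm $\|f\|_\infty+|a|$, and let $Z_n:=(Y^\circ(T_n),\eta^\circ(T_n))$, a random element of $S$. Let $\mathcal M$ be the set of Borel probability measures $\mu$ on $S$ with $\int(\|f\|_\infty^2+x^2)\,\mu(df,dx)<\infty$ and $\int x\,\mu(df,dx)=0$, and for $\mu,\nu\in\mathcal M$ let $d(\mu,\nu)\ge 0$ be defined by $$d(\mu,\nu)^2:=\inf\bigl\{\max\{E\|Y-\bar Y\|_\infty^2,\;7E(\eta-\bar\eta)^2\}:(Y,\eta)\sim\mu,\ (\bar Y,\bar\eta)\sim\nu\bigr\}.$$ For $f\in C_{00}[0,1]$ and $t\in[0,1]$ let $Af(t):=\frac12f(2t\wedge1)$, $Bf(t):=\frac12f((2t-1)^+)$ and $\phi(t):=\frac12(t\wedge(1-t))$. For a Borel probability measure $\mu$ on $S$ let $\Psi(\mu)$ be the law of $$\Bigl(AY+BY'+(\eta-\eta')\phi+(\log\xi-\log(1-\xi))\phi,\;\;1+\tfrac12(\eta+\eta')+\tfrac12(\log\xi+\log(1-\xi))\Bigr),$$ where $(Y,\eta)\sim\mu$, $(Y',\eta')\sim\mu$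 and $\xi\sim\mathrm{unif}(0,1)$ are independent. **Theorem 8.** The operator $\Psi$ maps $\mathcal M$ into $\mathcal M$ and is a strict contraction with respect to $d$: there is a constant $c\in[0,1)$ with $d(\Psi(\mu),\Psi(\nu))\le c\,d(\mu,\nu)$ for all $\mu,\nu\in\mathcal M$. It has exactly one fixed point $\mu_\infty$ in $\mathcal M$, and as $n\to\infty$, $Z_n$ converges in distribution in $S$ to a random element $Z_\infty$ with law $\mu_\infty$. -/

import Mathlib

open MeasureTheory ProbabilityTheory Filter Topology

noncomputable section

namespace BST

/-! ### Binary trees as prefix-stable sets of words -/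

/-- A rooted directed binary tree: a finite, prefix-stable set of finite words over `{0, 1}`.
The letter `false` is `0` (left), the letter `true` is `1` (right). -/
structure BinTree where
  nodes : Finset (List Bool)
  prefix_mem : ∀ (u : List Bool) (b : Bool), u ++ [b] ∈ nodes → u ∈ nodes

/-- The size `#T` of a tree. -/
def BinTree.size (T : BinTree) : ℕ := T.nodes.card

/-! ### The binary search tree algorithm -/

/-- Insertion of `x` into a labeled tree: move left if `x` is smaller than the label of the
current node, right otherwise, until an empty place is found. -/
def insertKey (x : ℝ) : BinaryTree ℝ → BinaryTree ℝ
  | .nil => .node x .nil .nil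
  | .node a l r => if x < a then .node a (insertKey x l) r else .node a l (insertKey x r)

/-- The labeled tree that stores `x 0, …, x (n - 1)`, inserted in this order. -/
def bstLabeled (x : ℕ → ℝ) : ℕ → BinaryTree ℝ
  | 0 => .nil
  | n + 1 => insertKey (x n) (bstLabeled x n)

/-- The set of addresses of the nodes of a labeled tree. -/
def addresses : BinaryTree ℝ → Finset (List Bool)
  | .nil => ∅
  | .node _ l r => insert [] ((addresses l).image (List.cons false) ∪
      (addresses r).image (List.cons true))

theorem addresses_prefix (t : BinaryTree ℝ) :
    ∀ (u : List Bool) (b : Bool), u ++ [b] ∈ addresses t → u ∈ addresses t := by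
  induction t with
  | nil => intro u b h; simp [addresses] at h
  | node a l r ihl ihr =>
    intro u b h
    cases u with
    | nil => simp [addresses]
    | cons c u =>
      simp only [addresses, List.cons_append, Finset.mem_insert, reduceCtorEq, Finset.mem_union,
        Finset.mem_image, List.cons.injEq, false_or] at h ⊢
      rcases h with ⟨v, hv, rfl, rfl⟩ | ⟨v, hv, rfl, rfl⟩
      · exact Or.inl ⟨u, ihl u b hv, rfl, rfl⟩
      · exact Or.inr ⟨u, ihr u b hv, rfl, rfl⟩

/-- The (unlabeled) binary tree `T_n` generated by the BST algorithm from the first `n` inputs. -/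
def bst (x : ℕ → ℝ) (n : ℕ) : BinTree :=
  ⟨addresses (bstLabeled x n), addresses_prefix _⟩

/-! ### The silhouette -/

/-- The binary digit `u_{i+1}` of `s ∈ [0, 1]`: binary rationals `s < 1` have the expansion that
ends in zeros, and `1 = 0.111…`. -/
def binDigit (s : ℝ) (i : ℕ) : Bool :=
  if s = 1 then true else decide (⌊(2 : ℝ) ^ (i + 1) * s⌋ % 2 = 1)

/-- The word `(u_1, …, u_k)` of the first `k` binary digits of `s`. -/
def binWord (s : ℝ) (k : ℕ) : List Bool := (List.range k).map (binDigit s)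

/-- The silhouette `X_s(T) = min {k : (u_1, …, u_k) ∉ T}`. -/
def silhouette (T : BinTree) (s : ℝ) : ℕ := sInf {k : ℕ | binWord s k ∉ T.nodes}

theorem exists_bound (T : BinTree) :
    ∃ K : ℕ, ∀ u : List Bool, K ≤ u.length → u ∉ T.nodes := by
  refine ⟨T.nodes.sup List.length + 1, fun u hu hm => ?_⟩
  have := Finset.le_sup (f := List.length) hm
  omega

theorem binWord_length (s : ℝ) (k : ℕ) : (binWord s k).length = k := by
  simp [binWord]

theorem silhouette_bounded (T : BinTree) : ∃ K : ℕ, ∀ s, silhouette T s ≤ K := by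
  obtain ⟨K, hK⟩ := exists_bound T
  exact ⟨K, fun s => Nat.sInf_le (hK _ (binWord_length s K).ge)⟩

theorem measurable_binDigit (i : ℕ) : Measurable fun s : ℝ => binDigit s i := by
  unfold binDigit
  refine Measurable.ite (measurableSet_singleton _) measurable_const ?_
  exact (measurable_from_top (f := fun z : ℤ => decide (z % 2 = 1))).comp
    (Int.measurable_floor.comp (measurable_const.mul measurable_id))

theorem measurableSet_binWord (k : ℕ) (u : List Bool) :
    MeasurableSet {s : ℝ | binWord s k = u} := by
  induction k generalizing u with
  | zero => simp [binWord]
  | succ k ih =>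
    rcases List.eq_nil_or_concat u with rfl | ⟨v, b, rfl⟩
    · convert MeasurableSet.empty (α := ℝ)
      ext s; simp [binWord]
    · have : {s : ℝ | binWord s (k + 1) = v ++ [b]} =
          {s | binWord s k = v} ∩ (fun s => binDigit s k) ⁻¹' {b} := by
        ext s; simp [binWord, List.range_succ]
      simpa [List.concat_eq_append, this] using
        (ih v).inter (measurable_binDigit k (measurableSet_singleton b))

theorem measurable_silhouette (T : BinTree) : Measurable (silhouette T) := by
  have hmem : ∀ k, MeasurableSet {s : ℝ | binWord s k ∈ T.nodes} := fun k => by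
    have : {s : ℝ | binWord s k ∈ T.nodes} = ⋃ u ∈ T.nodes, {s : ℝ | binWord s k = u} := by
      ext s; simp
    rw [this]
    exact Finset.measurableSet_biUnion _ fun u _ => measurableSet_binWord k u
  refine measurable_of_Iic fun m => ?_
  have : silhouette T ⁻¹' Set.Iic m = ⋃ k ∈ Finset.range (m + 1),
      {s : ℝ | binWord s k ∈ T.nodes}ᶜ := by
    ext s
    simp only [Set.mem_preimage, Set.mem_Iic, Set.mem_iUnion, Finset.mem_range, Set.mem_compl_iff,
      Set.mem_ofPred_eq, exists_prop]
    constructor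
    · intro h
      obtain ⟨K, hK⟩ := exists_bound T
      have hne : {k : ℕ | binWord s k ∉ T.nodes}.Nonempty := ⟨K, hK _ (binWord_length s K).ge⟩
      exact ⟨silhouette T s, Nat.lt_succ_of_le h, Nat.sInf_mem hne⟩
    · rintro ⟨k, hk, hk'⟩
      exact (Nat.sInf_le hk').trans (Nat.le_of_lt_succ hk)
  rw [this]
  exact Finset.measurableSet_biUnion _ fun k _ => (hmem k).compl

theorem intervalIntegrable_silhouette (T : BinTree) (a b : ℝ) :
    IntervalIntegrable (fun s => (silhouette T s : ℝ)) volume a b := by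
  obtain ⟨K, hK⟩ := silhouette_bounded T
  refine (intervalIntegrable_const (c := (K : ℝ))).mono_fun'
    (measurable_from_top.comp (measurable_silhouette T)).aestronglyMeasurable
    (Eventually.of_forall fun s => ?_)
  simpa using hK s

/-- The integrated silhouette `Y_t(T)`. -/
def intSilhouette (T : BinTree) (t : ℝ) : ℝ := ∫ s in (0 : ℝ)..t, (silhouette T s : ℝ)

/-- The discounted external path length `η(T)`, the integral of the silhouette over `[0, 1]`. -/
def pathLength (T : BinTree) : ℝ := ∫ s in (0 : ℝ)..1, (silhouette T s : ℝ)

/-- The centered discounted external path length `η°(T) = η(T) - H(#T)`. -/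
def centeredPathLength (T : BinTree) : ℝ := pathLength T - (harmonic T.size : ℝ)

/-! ### The state space -/

/-- The space `C₀₀[0, 1]` of continuous functions on `[0, 1]` that vanish at both ends, with the
supremum norm. -/
def C00Submodule : Submodule ℝ C(unitInterval, ℝ) where
  carrier := {f | f 0 = 0 ∧ f 1 = 0}
  zero_mem' := by simp
  add_mem' := by rintro f g ⟨hf, hf'⟩ ⟨hg, hg'⟩; simp [hf, hf', hg, hg']
  smul_mem' := by rintro c f ⟨hf, hf'⟩; simp [hf, hf']

abbrev C00 : Type := C00Submodule

instance : MeasurableSpace C00 := borel C00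

instance : BorelSpace C00 := ⟨rfl⟩

/-- The space `S = C₀₀[0, 1] × ℝ`. Its product topology is the one induced by the norm
`‖f‖_∞ + |a|`, and its σ-algebra is the Borel σ-algebra. -/
abbrev S : Type := C00 × ℝ

instance : BorelSpace S := inferInstance

/-- The normalized integrated silhouette `Y°_t(T) = Y_t(T) - t Y_1(T)`. -/
def normSilhouette (T : BinTree) : C00 :=
  ⟨⟨fun t => intSilhouette T t - t * intSilhouette T 1, by
      have h : Continuous (intSilhouette T) :=
        intervalIntegral.continuous_primitive (intervalIntegrable_silhouette T) 0
      fun_prop⟩, by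
    constructor <;> simp [intSilhouette]⟩

/-- The pair `(Y°(T), η°(T))`. -/
def pair (T : BinTree) : S := (normSilhouette T, centeredPathLength T)

/-! ### The operator `Ψ` -/

/-- `A f (t) = ½ f (2t ∧ 1)`. -/
def opA : C00 →ₗ[ℝ] C00 where
  toFun f := ⟨⟨fun t => 1 / 2 * f.1 ⟨min (2 * (t : ℝ)) 1,
      le_min (by linarith [t.2.1]) zero_le_one, min_le_right _ _⟩, by fun_prop⟩, by
    have h0 := f.2.1
    have h1 := f.2.2
    constructor
    · simpa using h0
    · simpa [show min (2 : ℝ) 1 = 1 by norm_num] using h1⟩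
  map_add' f g := by ext t; simp [mul_add]
  map_smul' c f := by ext t; simp; ring

/-- `B f (t) = ½ f ((2t - 1)⁺)`. -/
def opB : C00 →ₗ[ℝ] C00 where
  toFun f := ⟨⟨fun t => 1 / 2 * f.1 ⟨max (2 * (t : ℝ) - 1) 0,
      le_max_right _ _, max_le (by linarith [t.2.2]) zero_le_one⟩, by fun_prop⟩, by
    have h0 := f.2.1
    have h1 := f.2.2
    constructor
    · simpa [show max (-1 : ℝ) 0 = 0 by norm_num] using h0
    · simpa [show (2 : ℝ) - 1 = 1 by norm_num] using h1⟩
  map_add' f g := by ext t; simp [mul_add]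
  map_smul' c f := by ext t; simp; ring

/-- `φ(t) = ½ (t ∧ (1 - t))`. -/
def phi : C00 :=
  ⟨⟨fun t => 1 / 2 * min (t : ℝ) (1 - t), by fun_prop⟩, by constructor <;> simp⟩

/-- The uniform distribution on the unit interval. -/
def unif : Measure ℝ := volume.restrict (Set.Icc 0 1)

instance : IsProbabilityMeasure unif := ⟨by simp [unif]⟩

/-- The map `((Y, η), (Y', η'), ξ) ↦ (A Y + B Y' + (η - η') φ + (log ξ - log (1 - ξ)) φ,
1 + ½ (η + η') + ½ (log ξ + log (1 - ξ)))`. -/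
def step (p : S × S × ℝ) : S :=
  (opA p.1.1 + opB p.2.1.1 + (p.1.2 - p.2.1.2) • phi
      + (Real.log p.2.2 - Real.log (1 - p.2.2)) • phi,
    1 + 1 / 2 * (p.1.2 + p.2.1.2) + 1 / 2 * (Real.log p.2.2 + Real.log (1 - p.2.2)))

theorem norm_opA_le (f : C00) : ‖opA f‖ ≤ 1 * ‖f‖ := by
  rw [one_mul]
  change ‖(opA f).1‖ ≤ ‖f.1‖
  rw [ContinuousMap.norm_le _ (norm_nonneg _)]
  intro t
  have h := f.1.norm_coe_le_norm ⟨min (2 * (t : ℝ)) 1,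
      le_min (by linarith [t.2.1]) zero_le_one, min_le_right _ _⟩
  have h' := norm_nonneg f.1
  change ‖1 / 2 * f.1 _‖ ≤ _
  rw [norm_mul]
  norm_num at h ⊢
  linarith

theorem norm_opB_le (f : C00) : ‖opB f‖ ≤ 1 * ‖f‖ := by
  rw [one_mul]
  change ‖(opB f).1‖ ≤ ‖f.1‖
  rw [ContinuousMap.norm_le _ (norm_nonneg _)]
  intro t
  have h := f.1.norm_coe_le_norm ⟨max (2 * (t : ℝ) - 1) 0,
      le_max_right _ _, max_le (by linarith [t.2.2]) zero_le_one⟩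
  have h' := norm_nonneg f.1
  change ‖1 / 2 * f.1 _‖ ≤ _
  rw [norm_mul]
  norm_num at h ⊢
  linarith

theorem measurable_step : Measurable step := by
  have hA : Measurable opA :=
    (AddMonoidHomClass.continuous_of_bound opA 1 norm_opA_le).measurable
  have hB : Measurable opB :=
    (AddMonoidHomClass.continuous_of_bound opB 1 norm_opB_le).measurable
  unfold step
  fun_prop

/-- The operator `Ψ`: `Ψ(μ)` is the law of `step ((Y, η), (Y', η'), ξ)` for independent
`(Y, η) ∼ μ`, `(Y', η') ∼ μ` and `ξ ∼ unif(0, 1)`. -/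
def Psi (μ : ProbabilityMeasure S) : ProbabilityMeasure S :=
  ⟨((μ : Measure S).prod ((μ : Measure S).prod unif)).map step,
    Measure.isProbabilityMeasure_map measurable_step.aemeasurable⟩

/-- The space `𝓜` of laws on `S` with finite second moments and centered second component. -/
def M : Set (ProbabilityMeasure S) :=
  {μ | Integrable (fun z : S => ‖z.1‖ ^ 2 + z.2 ^ 2) (μ : Measure S) ∧
    ∫ z : S, z.2 ∂(μ : Measure S) = 0}

/-- `π` is a coupling of `μ` and `ν`: the joint law of a pair of random elements with marginal
laws `μ` and `ν`. -/
def IsCoupling (π : Measure (S × S)) (μ ν : ProbabilityMeasure S) : Prop :=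
  π.map Prod.fst = μ ∧ π.map Prod.snd = ν

/-- The distance `d` on `𝓜`: `d(μ, ν)²` is the infimum of
`max {E ‖Y - Ȳ‖², 7 E (η - η̄)²}` over the couplings of `(Y, η) ∼ μ` and `(Ȳ, η̄) ∼ ν`. All
these expectations are finite for `μ, ν ∈ 𝓜`. -/
def wDist (μ ν : ProbabilityMeasure S) : ℝ :=
  Real.sqrt (sInf {c : ℝ | ∃ π : Measure (S × S), IsCoupling π μ ν ∧
    c = max (∫ p, ‖p.1.1 - p.2.1‖ ^ 2 ∂π) (7 * ∫ p, (p.1.2 - p.2.2) ^ 2 ∂π)})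

end BST

end

open MeasureTheory ProbabilityTheory Filter Topology

noncomputable section

set_option linter.unusedSectionVars false

namespace BST

/-! ### The recursion on a general Banach space -/

/-! Everything about `opA`, `opB` and `phi` that the contraction arguments need is one inequality,
`norm_sq_le`, so the analysis is done for an affine recursion on `E × ℝ` with `E` a normed space.
For two independent centered copies, the second components add in variance and are halved, so their
mean square is multiplied by 1/2. The mean square norm of the first component is multiplied by at
most 3/4, up to 3/8 times that of the second component. A suitable weighting of the two gives a
strict contraction.

For the distance, a coupling of `μ` and `ν` is used twice independently, together with one common
uniform variable, so that the logarithms cancel (`exists_isCoupling_Psi`). A vanishing distance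
forces equality of laws by testing with bounded Lipschitz functions (`eq_of_wDist_eq_zero`), which
gives uniqueness of the fixed point.

Existence is obtained on a concrete probability space instead of in the metric space of laws. The
nodes of the infinite binary tree carry independent uniform labels. The root label and the two
subtrees' label families are independent, and each family has the same law as the whole
(`measurePreserving_splitLabels`). Hence `Ψ` lifts to an operator on random variables (`law_lift`),
whose iterates from 0 are Cauchy in L². Their limit `Z` is almost surely fixed, and its law is the
fixed point.

The same labels drive random trees: the root label `u` gives the left subtree the size `⌊(n + 1)u⌋`,
uniform on `{0, …, n}`, and the subtrees are built from their own labels. The pair `(Y°, η°)`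
satisfies the recursion with differences of harmonic numbers in place of logarithms
(`shapePair_node`), and these differences converge in L² to the logarithms. The squared L² distance
to `Z` is then at most a constant less than 1 times its Cesàro mean over smaller sizes, plus a null
sequence, hence tends to 0 (`tendsto_zero_of_le_mean`, `tendsto_gap`).

It remains to see that the search tree of uniform keys has the law of this random tree
(`pi_unif_bstShape_eq`). By induction on the tree, the volume of the key vectors in `[c, d)` with a
given shape follows from conditioning on the root key, choosing which keys are smaller, and a beta
integral. -/

/-- The data of an affine recursion on `E × ℝ` of the type that defines `Ψ`. -/
structure AffineRec (E : Type*) [NormedAddCommGroup E] [NormedSpace ℝ E] where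
  A : E →L[ℝ] E
  B : E →L[ℝ] E
  φ : E
  -- The factor 3/8 < 1/2 is decisive: two copies then contribute a total factor 3/4 < 1.
  norm_sq_le : ∀ (x y : E) (c : ℝ),
    ‖A x + B y + c • φ‖ ^ 2 ≤ 3 / 8 * (‖x‖ ^ 2 + ‖y‖ ^ 2) + 3 / 16 * c ^ 2

namespace AffineRec

section Algebra

variable {E : Type*} [NormedAddCommGroup E] [NormedSpace ℝ E] (R : AffineRec E)

/-- One step of the recursion, with free logarithmic terms `a` and `b`. -/
def combine (z z' : E × ℝ) (a b : ℝ) : E × ℝ :=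
  (R.A z.1 + R.B z'.1 + (z.2 - z'.2) • R.φ + (a - b) • R.φ,
    1 + 1 / 2 * (z.2 + z'.2) + 1 / 2 * (a + b))

/-- The linear part of `AffineRec.combine`. -/
def combineLin (d d' : E × ℝ) (a b : ℝ) : E × ℝ :=
  (R.A d.1 + R.B d'.1 + (d.2 - d'.2 + (a - b)) • R.φ, 1 / 2 * (d.2 + d'.2 + (a + b)))

/-- The map is affine, so the additive constant drops out, and with equal logarithmic terms these
drop out as well. -/
theorem combine_sub_combine (z z' w w' : E × ℝ) (a b a' b' : ℝ) :
    R.combine z z' a b - R.combine w w' a' b' =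
      R.combineLin (z - w) (z' - w') (a - a') (b - b') := by
  ext1
  · simp only [combine, combineLin, Prod.fst_sub, Prod.snd_sub, map_sub]
    module
  · simp only [combine, combineLin, Prod.snd_sub]
    ring

theorem combine_eq_combineLin_add (z z' : E × ℝ) (a b : ℝ) :
    R.combine z z' a b = R.combineLin z z' a b + (0, 1) := by
  ext1
  · simp only [combine, combineLin, Prod.fst_add]
    module
  · simp only [combine, combineLin, Prod.snd_add]
    ring

/-- The counterpart of `BST.step`. -/
def step (p : (E × ℝ) × (E × ℝ) × ℝ) : E × ℝ :=
  R.combine p.1 p.2.1 (Real.log p.2.2) (Real.log (1 - p.2.2))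

theorem continuous_combineLin : Continuous fun p : (E × ℝ) × (E × ℝ) × ℝ × ℝ =>
    R.combineLin p.1 p.2.1 p.2.2.1 p.2.2.2 := by
  unfold combineLin
  fun_prop

end Algebra

/-! ### Second moments -/

section Moments

variable {E : Type*} [NormedAddCommGroup E]
  {Ω Ω' : Type*} [MeasurableSpace Ω] [MeasurableSpace Ω']
  {P : Measure Ω} {P' : Measure Ω'} {D : Ω → E × ℝ} {D' : Ω' → E × ℝ}

theorem memLp_fst (h : MemLp D 2 P) : MemLp (fun ω => (D ω).1) 2 P :=
  h.mono (continuous_fst.comp_aestronglyMeasurable h.1) (ae_of_all _ fun _ => norm_fst_le _)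

theorem memLp_snd (h : MemLp D 2 P) : MemLp (fun ω => (D ω).2) 2 P :=
  h.mono (continuous_snd.comp_aestronglyMeasurable h.1) (ae_of_all _ fun _ => norm_snd_le _)

theorem memLp_of_fst_snd (h₁ : MemLp (fun ω => (D ω).1) 2 P)
    (h₂ : MemLp (fun ω => (D ω).2) 2 P) : MemLp D 2 P := by
  refine (h₁.norm.add h₂.norm).mono (h₁.1.prodMk h₂.1) (ae_of_all _ fun ω => ?_)
  exact (max_le (le_add_of_nonneg_right (norm_nonneg _))
    (le_add_of_nonneg_left (norm_nonneg _))).trans (le_abs_self _)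

theorem integrable_norm_fst_sq (h : MemLp D 2 P) : Integrable (fun ω => ‖(D ω).1‖ ^ 2) P :=
  (memLp_fst h).integrable_norm_pow (by norm_num)

theorem integrable_snd_sq (h : MemLp D 2 P) : Integrable (fun ω => (D ω).2 ^ 2) P :=
  (memLp_snd h).integrable_sq

theorem memLp_of_integrable_sq (hm : AEStronglyMeasurable D P)
    (h₁ : Integrable (fun ω => ‖(D ω).1‖ ^ 2) P) (h₂ : Integrable (fun ω => (D ω).2 ^ 2) P) :
    MemLp D 2 P :=
  memLp_of_fst_snd
    ((memLp_two_iff_integrable_sq_norm (continuous_fst.comp_aestronglyMeasurable hm)).2 h₁)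
    ((memLp_two_iff_integrable_sq (continuous_snd.comp_aestronglyMeasurable hm)).2 h₂)

variable [NormedSpace ℝ E] (R : AffineRec E)

theorem norm_combineLin_fst_sq_le (d d' : E × ℝ) (a b : ℝ) :
    ‖(R.combineLin d d' a b).1‖ ^ 2 ≤
      3 / 8 * (‖d.1‖ ^ 2 + ‖d'.1‖ ^ 2) + 3 / 16 * (d.2 - d'.2 + (a - b)) ^ 2 :=
  R.norm_sq_le _ _ _

theorem memLp_combineLin {D D' : Ω → E × ℝ} {a b : Ω → ℝ} (hD : MemLp D 2 P)
    (hD' : MemLp D' 2 P) (ha : MemLp a 2 P) (hb : MemLp b 2 P) :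
    MemLp (fun ω => R.combineLin (D ω) (D' ω) (a ω) (b ω)) 2 P := by
  have hm : AEStronglyMeasurable (fun ω => R.combineLin (D ω) (D' ω) (a ω) (b ω)) P :=
    R.continuous_combineLin.comp_aestronglyMeasurable
      (hD.1.prodMk (hD'.1.prodMk (ha.1.prodMk hb.1)))
  have h3 : Integrable (fun ω => ((D ω).2 - (D' ω).2 + (a ω - b ω)) ^ 2) P :=
    (((memLp_snd hD).sub (memLp_snd hD')).add (ha.sub hb)).integrable_sq
  refine memLp_of_integrable_sq hm ?_ ?_
  · refine Integrable.mono' ((((integrable_norm_fst_sq hD).add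
      (integrable_norm_fst_sq hD')).const_mul (3 / 8)).add (h3.const_mul (3 / 16)))
      ((continuous_fst.comp_aestronglyMeasurable hm).norm.pow 2) (ae_of_all _ fun ω => ?_)
    rw [Real.norm_of_nonneg (by positivity)]
    exact R.norm_combineLin_fst_sq_le _ _ _ _
  · exact ((((memLp_snd hD).add (memLp_snd hD')).add (ha.add hb)).const_mul (1 / 2)).integrable_sq

theorem memLp_combine [IsFiniteMeasure P] {D D' : Ω → E × ℝ} {a b : Ω → ℝ} (hD : MemLp D 2 P)
    (hD' : MemLp D' 2 P) (ha : MemLp a 2 P) (hb : MemLp b 2 P) :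
    MemLp (fun ω => R.combine (D ω) (D' ω) (a ω) (b ω)) 2 P := by
  simp only [combine_eq_combineLin_add]
  exact (R.memLp_combineLin hD hD' ha hb).add (memLp_const _)

variable [IsProbabilityMeasure P] [IsProbabilityMeasure P']

/-- The mixed term vanishes by independence and centering, the terms linear in `X` or `Y` by
centering alone. This is where the restriction to centered second components pays off. -/
theorem integral_prod_add_add_sq {X : Ω → ℝ} {Y : Ω' → ℝ} (hX : MemLp X 2 P) (hY : MemLp Y 2 P')
    (hX0 : ∫ ω, X ω ∂P = 0) (hY0 : ∫ ω, Y ω ∂P' = 0) (c : ℝ) :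
    Integrable (fun p : Ω × Ω' => (X p.1 + Y p.2 + c) ^ 2) (P.prod P') ∧
    ∫ p, (X p.1 + Y p.2 + c) ^ 2 ∂(P.prod P') = ∫ ω, X ω ^ 2 ∂P + ∫ ω, Y ω ^ 2 ∂P' + c ^ 2 := by
  have iX : Integrable X P := hX.integrable (by norm_num)
  have iY : Integrable Y P' := hY.integrable (by norm_num)
  have e : (fun p : Ω × Ω' => (X p.1 + Y p.2 + c) ^ 2) = fun p =>
      X p.1 ^ 2 + (Y p.2 ^ 2 + (c ^ 2 +
        (2 * (X p.1 * Y p.2) + (2 * c * X p.1 + 2 * c * Y p.2)))) := by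
    ext p; ring
  have i1 : Integrable (fun p : Ω × Ω' => X p.1 ^ 2) (P.prod P') := hX.integrable_sq.comp_fst P'
  have i2 : Integrable (fun p : Ω × Ω' => Y p.2 ^ 2) (P.prod P') := hY.integrable_sq.comp_snd P
  have i3 : Integrable (fun p : Ω × Ω' => 2 * (X p.1 * Y p.2)) (P.prod P') :=
    (iX.mul_prod iY).const_mul 2
  have i4 : Integrable (fun p : Ω × Ω' => 2 * c * X p.1) (P.prod P') :=
    (iX.comp_fst P').const_mul _
  have i5 : Integrable (fun p : Ω × Ω' => 2 * c * Y p.2) (P.prod P') :=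
    (iY.comp_snd P).const_mul _
  have i6 : Integrable (fun _ : Ω × Ω' => c ^ 2) (P.prod P') := integrable_const _
  have i45 := i4.add i5
  have i345 := i3.add i45
  have i6' := i6.add i345
  have i2' := i2.add i6'
  rw [e]
  refine ⟨i1.add i2', ?_⟩
  erw [integral_add i1 i2', integral_add i2 i6', integral_add i6 i345, integral_add i3 i45,
    integral_add i4 i5]
  simp only [integral_const_mul]
  rw [integral_prod_mul, hX0, integral_fun_fst (f := fun x => X x ^ 2),
    integral_fun_snd (f := fun x => Y x ^ 2), integral_fun_fst (f := X),
    integral_fun_snd (f := Y), hX0, hY0]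
  simp
  ring

theorem integral_combineLin_snd_sq (hD : MemLp D 2 P)
    (hD' : MemLp D' 2 P') (h0 : ∫ ω, (D ω).2 ∂P = 0) (h0' : ∫ ω, (D' ω).2 ∂P' = 0) (a b : ℝ) :
    ∫ p, (R.combineLin (D p.1) (D' p.2) a b).2 ^ 2 ∂(P.prod P') =
      1 / 4 * (∫ ω, (D ω).2 ^ 2 ∂P + ∫ ω, (D' ω).2 ^ 2 ∂P' + (a + b) ^ 2) := by
  rw [← (integral_prod_add_add_sq (memLp_snd hD) (memLp_snd hD') h0 h0' (a + b)).2,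
    ← integral_const_mul]
  congr with p
  simp only [combineLin]
  ring

theorem memLp_combineLin_prod (hD : MemLp D 2 P) (hD' : MemLp D' 2 P') (a b : ℝ) :
    MemLp (fun p : Ω × Ω' => R.combineLin (D p.1) (D' p.2) a b) 2 (P.prod P') :=
  R.memLp_combineLin (hD.comp_fst P') (hD'.comp_snd P) (memLp_const a) (memLp_const b)

theorem integral_combineLin_fst_sq_le (hD : MemLp D 2 P)
    (hD' : MemLp D' 2 P') (h0 : ∫ ω, (D ω).2 ∂P = 0) (h0' : ∫ ω, (D' ω).2 ∂P' = 0) (a b : ℝ) :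
    ∫ p, ‖(R.combineLin (D p.1) (D' p.2) a b).1‖ ^ 2 ∂(P.prod P') ≤
      3 / 8 * (∫ ω, ‖(D ω).1‖ ^ 2 ∂P + ∫ ω, ‖(D' ω).1‖ ^ 2 ∂P') +
      3 / 16 * (∫ ω, (D ω).2 ^ 2 ∂P + ∫ ω, (D' ω).2 ^ 2 ∂P' + (a - b) ^ 2) := by
  -- The first component contains the difference of the second components, so the expansion is
  -- applied to the negated copy, which has the same second moment.
  have hY0 : ∫ ω, -(D' ω).2 ∂P' = 0 := by rw [integral_neg, h0', neg_zero]
  obtain ⟨hi, he⟩ := integral_prod_add_add_sq (memLp_snd hD) (memLp_snd hD').neg h0 hY0 (a - b)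
  simp only [Pi.neg_apply, neg_sq, ← sub_eq_add_neg] at hi he
  have i1 : Integrable (fun p : Ω × Ω' => ‖(D p.1).1‖ ^ 2) (P.prod P') :=
    (integrable_norm_fst_sq hD).comp_fst P'
  have i2 : Integrable (fun p : Ω × Ω' => ‖(D' p.2).1‖ ^ 2) (P.prod P') :=
    (integrable_norm_fst_sq hD').comp_snd P
  have i3 : Integrable (fun p : Ω × Ω' => 3 / 8 * (‖(D p.1).1‖ ^ 2 + ‖(D' p.2).1‖ ^ 2))
      (P.prod P') := (i1.add i2).const_mul (3 / 8)
  have i4 := hi.const_mul (3 / 16)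
  have hle := integral_mono (integrable_norm_fst_sq (R.memLp_combineLin_prod hD hD' a b))
    (i3.add i4) (fun p => R.norm_combineLin_fst_sq_le (D p.1) (D' p.2) a b)
  refine hle.trans_eq ?_
  have e3 := integral_fun_fst (μ := P) (ν := P') (f := fun x => ‖(D x).1‖ ^ 2)
  have e4 := integral_fun_snd (μ := P) (ν := P') (f := fun x => ‖(D' x).1‖ ^ 2)
  simp only [probReal_univ, one_smul] at e3 e4
  refine (integral_add i3 i4).trans ?_
  rw [integral_const_mul, integral_const_mul, he, integral_add i1 i2, e3, e4]

end Moments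

end AffineRec

/-! ### Logarithms of uniform variables -/

theorem unif_eq_restrict_Ioc : unif = volume.restrict (Set.Ioc 0 1) :=
  (restrict_Ioc_eq_restrict_Icc).symm

theorem integral_unif (f : ℝ → ℝ) : ∫ u, f u ∂unif = ∫ u in (0 : ℝ)..1, f u := by
  rw [unif_eq_restrict_Ioc, intervalIntegral.integral_of_le zero_le_one]

theorem integrable_unif_iff (f : ℝ → ℝ) :
    Integrable f unif ↔ IntervalIntegrable f volume 0 1 := by
  rw [unif_eq_restrict_Ioc, intervalIntegrable_iff_integrableOn_Ioc_of_le zero_le_one]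
  rfl

theorem measurePreserving_one_sub_unif : MeasurePreserving (fun u : ℝ => 1 - u) unif unif := by
  have h := (Measure.measurePreserving_sub_left (volume : Measure ℝ) 1).restrict_preimage
    (measurableSet_Icc (a := (0 : ℝ)) (b := 1))
  have e : (fun u : ℝ => 1 - u) ⁻¹' Set.Icc 0 1 = Set.Icc 0 1 := by
    ext u; simp
  rwa [e] at h

/-- Square of `log (1/u) ≤ 4 u^(-1/4)`; the resulting power is integrable at 0, which puts the
logarithm in L². -/
theorem log_sq_le {u : ℝ} (h0 : 0 < u) (h1 : u ≤ 1) :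
    Real.log u ^ 2 ≤ 16 * u ^ (-(1 / 2) : ℝ) := by
  have h := Real.log_le_rpow_div (inv_pos.2 h0).le (by norm_num : (0 : ℝ) < 1 / 4)
  rw [Real.log_inv] at h
  have hlog : 0 ≤ -Real.log u := by linarith [Real.log_nonpos h0.le h1]
  have h2 := pow_le_pow_left₀ hlog h 2
  have e : (u⁻¹ ^ (1 / 4 : ℝ)) ^ 2 = u ^ (-(1 / 2) : ℝ) := by
    rw [← Real.rpow_natCast, ← Real.rpow_mul (inv_pos.2 h0).le, Real.inv_rpow h0.le,
      ← Real.rpow_neg h0.le]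
    norm_num
  rw [div_pow, e] at h2
  nlinarith

theorem memLp_log : MemLp Real.log 2 unif := by
  rw [memLp_two_iff_integrable_sq Real.measurable_log.aestronglyMeasurable]
  have h : Integrable (fun u : ℝ => 16 * u ^ (-(1 / 2) : ℝ)) unif := by
    rw [integrable_unif_iff]
    exact (intervalIntegral.intervalIntegrable_rpow' (by norm_num)).const_mul 16
  refine h.mono' (by fun_prop) ?_
  rw [unif_eq_restrict_Ioc]
  filter_upwards [ae_restrict_mem measurableSet_Ioc] with u hu
  rw [Real.norm_of_nonneg (sq_nonneg _)]
  exact log_sq_le hu.1 hu.2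

theorem memLp_log_one_sub : MemLp (fun u => Real.log (1 - u)) 2 unif :=
  memLp_log.comp_measurePreserving measurePreserving_one_sub_unif

theorem integral_log_unif : ∫ u, Real.log u ∂unif = -1 := by
  rw [integral_unif]
  simp

theorem integral_log_one_sub_unif : ∫ u, Real.log (1 - u) ∂unif = -1 := by
  have h := integral_map (μ := unif) (φ := fun u : ℝ => 1 - u) (by fun_prop)
    Real.measurable_log.aestronglyMeasurable
  rw [measurePreserving_one_sub_unif.map_eq, integral_log_unif] at h
  exact h.symm

/-! ### The operator on laws, the coupling distance, contraction and uniqueness -/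

namespace AffineRec

section Operator

variable {E : Type*} [NormedAddCommGroup E] [NormedSpace ℝ E] (R : AffineRec E)
  [MeasurableSpace E] [BorelSpace E] [SecondCountableTopology E]

theorem measurable_step : Measurable R.step := by
  unfold step combine
  fun_prop

/-- The counterpart of `BST.Psi`. -/
def Psi (μ : ProbabilityMeasure (E × ℝ)) : ProbabilityMeasure (E × ℝ) :=
  ⟨((μ : Measure (E × ℝ)).prod ((μ : Measure (E × ℝ)).prod unif)).map R.step,
    Measure.isProbabilityMeasure_map R.measurable_step.aemeasurable⟩

variable (E) in
/-- The counterpart of `BST.M`. -/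
def M : Set (ProbabilityMeasure (E × ℝ)) :=
  {μ | Integrable (fun z : E × ℝ => ‖z.1‖ ^ 2 + z.2 ^ 2) (μ : Measure (E × ℝ)) ∧
    ∫ z : E × ℝ, z.2 ∂(μ : Measure (E × ℝ)) = 0}

theorem mem_M_iff {μ : ProbabilityMeasure (E × ℝ)} :
    μ ∈ M E ↔ MemLp (fun z : E × ℝ => z) 2 (μ : Measure (E × ℝ)) ∧
      ∫ z : E × ℝ, z.2 ∂(μ : Measure (E × ℝ)) = 0 := by
  refine and_congr_left fun _ => ⟨fun h => ?_, fun h =>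
    (integrable_norm_fst_sq h).add (integrable_snd_sq h)⟩
  refine memLp_of_integrable_sq measurable_id.aestronglyMeasurable ?_ ?_
  · refine h.mono' (by fun_prop) (ae_of_all _ fun z => ?_)
    rw [Real.norm_of_nonneg (sq_nonneg _)]
    exact le_add_of_nonneg_right (sq_nonneg _)
  · refine h.mono' (by fun_prop) (ae_of_all _ fun z => ?_)
    rw [Real.norm_of_nonneg (sq_nonneg _)]
    exact le_add_of_nonneg_left (sq_nonneg _)

/-- Centering is preserved because `E log ξ = E log (1 - ξ) = -1`, so the logarithmic term has mean
`-1` and cancels the constant 1. -/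
theorem Psi_mem_M {μ : ProbabilityMeasure (E × ℝ)} (hμ : μ ∈ M E) : R.Psi μ ∈ M E := by
  rw [mem_M_iff] at hμ ⊢
  obtain ⟨hL, h0⟩ := hμ
  set m : Measure (E × ℝ) := (μ : Measure (E × ℝ))
  have d1 : MemLp (fun p : (E × ℝ) × (E × ℝ) × ℝ => p.1) 2 (m.prod (m.prod unif)) :=
    hL.comp_fst _
  have d2 : MemLp (fun p : (E × ℝ) × (E × ℝ) × ℝ => p.2.1) 2 (m.prod (m.prod unif)) :=
    (hL.comp_fst unif).comp_snd m
  have d3 : MemLp (fun p : (E × ℝ) × (E × ℝ) × ℝ => Real.log p.2.2) 2 (m.prod (m.prod unif)) :=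
    (memLp_log.comp_snd m).comp_snd m
  have d4 : MemLp (fun p : (E × ℝ) × (E × ℝ) × ℝ => Real.log (1 - p.2.2)) 2
      (m.prod (m.prod unif)) :=
    (memLp_log_one_sub.comp_snd m).comp_snd m
  have hs : MemLp R.step 2 (m.prod (m.prod unif)) := R.memLp_combine d1 d2 d3 d4
  refine ⟨(memLp_map_measure_iff measurable_id.aestronglyMeasurable
    R.measurable_step.aemeasurable).2 hs, ?_⟩
  change ∫ z, z.2 ∂((m.prod (m.prod unif)).map R.step) = 0
  rw [integral_map R.measurable_step.aemeasurable (by fun_prop)]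
  have i1 := ((memLp_snd d1).integrable (by norm_num)).const_mul (1 / 2)
  have i2 := ((memLp_snd d2).integrable (by norm_num)).const_mul (1 / 2)
  have i3 := (d3.integrable (by norm_num)).const_mul (1 / 2)
  have i4 := (d4.integrable (by norm_num)).const_mul (1 / 2)
  have i0 : Integrable (fun _ : (E × ℝ) × (E × ℝ) × ℝ => (1 : ℝ)) (m.prod (m.prod unif)) :=
    integrable_const _
  have e : (fun p : (E × ℝ) × (E × ℝ) × ℝ => (R.step p).2) = fun p =>
      1 + 1 / 2 * p.1.2 + 1 / 2 * p.2.1.2 + 1 / 2 * Real.log p.2.2 +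
        1 / 2 * Real.log (1 - p.2.2) := by
    ext p; simp only [step, combine]; ring
  have e1 : ∫ p : (E × ℝ) × (E × ℝ) × ℝ, p.1.2 ∂(m.prod (m.prod unif)) = 0 := by
    rw [integral_fun_fst (f := fun z : E × ℝ => z.2), h0]; simp
  have e2 : ∫ p : (E × ℝ) × (E × ℝ) × ℝ, p.2.1.2 ∂(m.prod (m.prod unif)) = 0 := by
    rw [integral_fun_snd (f := fun z : (E × ℝ) × ℝ => z.1.2),
      integral_fun_fst (f := fun z : E × ℝ => z.2), h0]; simp
  have e3 : ∫ p : (E × ℝ) × (E × ℝ) × ℝ, Real.log p.2.2 ∂(m.prod (m.prod unif)) = -1 := by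
    rw [integral_fun_snd (f := fun z : (E × ℝ) × ℝ => Real.log z.2),
      integral_fun_snd (f := fun z : ℝ => Real.log z), integral_log_unif]; simp
  have e4 : ∫ p : (E × ℝ) × (E × ℝ) × ℝ, Real.log (1 - p.2.2) ∂(m.prod (m.prod unif)) = -1 := by
    rw [integral_fun_snd (f := fun z : (E × ℝ) × ℝ => Real.log (1 - z.2)),
      integral_fun_snd (f := fun z : ℝ => Real.log (1 - z)), integral_log_one_sub_unif]; simp
  rw [e]
  erw [integral_add (((i0.add i1).add i2).add i3) i4, integral_add ((i0.add i1).add i2) i3,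
    integral_add (i0.add i1) i2, integral_add i0 i1]
  simp only [integral_const_mul, e1, e2, e3, e4]
  simp
  norm_num

/-- The counterpart of `BST.IsCoupling`. -/
def IsCoupling (π : Measure ((E × ℝ) × (E × ℝ))) (μ ν : ProbabilityMeasure (E × ℝ)) : Prop :=
  π.map Prod.fst = μ ∧ π.map Prod.snd = ν

/-- The cost of a coupling. -/
def cost (π : Measure ((E × ℝ) × (E × ℝ))) : ℝ :=
  max (∫ p, ‖p.1.1 - p.2.1‖ ^ 2 ∂π) (7 * ∫ p, (p.1.2 - p.2.2) ^ 2 ∂π)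

/-- The counterpart of `BST.wDist`. -/
def wDist (μ ν : ProbabilityMeasure (E × ℝ)) : ℝ :=
  Real.sqrt (sInf {c : ℝ | ∃ π : Measure ((E × ℝ) × (E × ℝ)), IsCoupling π μ ν ∧ c = cost π})

variable {R}
variable {μ ν : ProbabilityMeasure (E × ℝ)} {π : Measure ((E × ℝ) × (E × ℝ))}

theorem IsCoupling.isProbabilityMeasure (h : IsCoupling π μ ν) : IsProbabilityMeasure π := by
  have : IsProbabilityMeasure (π.map Prod.fst) := by rw [h.1]; infer_instance
  exact Measure.isProbabilityMeasure_of_map Prod.fst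

theorem isCoupling_prod (μ ν : ProbabilityMeasure (E × ℝ)) :
    IsCoupling ((μ : Measure (E × ℝ)).prod (ν : Measure (E × ℝ))) μ ν := by
  constructor <;> simp

theorem IsCoupling.memLp_sub (h : IsCoupling π μ ν) (hμ : μ ∈ M E) (hν : ν ∈ M E) :
    MemLp (fun p : (E × ℝ) × (E × ℝ) => p.1 - p.2) 2 π := by
  have h1 := (mem_M_iff.1 hμ).1
  have h2 := (mem_M_iff.1 hν).1
  rw [← h.1] at h1
  rw [← h.2] at h2
  exact (h1.comp_of_map measurable_fst.aemeasurable).sub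
    (h2.comp_of_map measurable_snd.aemeasurable)

theorem IsCoupling.integral_sub_snd (h : IsCoupling π μ ν) (hμ : μ ∈ M E) (hν : ν ∈ M E) :
    ∫ p : (E × ℝ) × (E × ℝ), (p.1 - p.2).2 ∂π = 0 := by
  have h1 := mem_M_iff.1 hμ
  have h2 := mem_M_iff.1 hν
  rw [← h.1] at h1
  rw [← h.2] at h2
  have i1 := (memLp_snd (h1.1.comp_of_map measurable_fst.aemeasurable))
  have i2 := (memLp_snd (h2.1.comp_of_map measurable_snd.aemeasurable))
  have := h.isProbabilityMeasure
  simp only [Prod.snd_sub]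
  rw [integral_sub]
  · rw [integral_map (by fun_prop) (by fun_prop)] at h1 h2
    rw [h1.2, h2.2, sub_zero]
  · exact i1.integrable (by norm_num)
  · exact i2.integrable (by norm_num)

theorem cost_nonneg (π : Measure ((E × ℝ) × (E × ℝ))) : 0 ≤ cost π :=
  le_max_of_le_left (integral_nonneg fun _ => sq_nonneg _)

theorem bddBelow_cost (μ ν : ProbabilityMeasure (E × ℝ)) :
    BddBelow {c : ℝ | ∃ π : Measure ((E × ℝ) × (E × ℝ)), IsCoupling π μ ν ∧ c = cost π} :=
  ⟨0, by rintro _ ⟨π, -, rfl⟩; exact cost_nonneg π⟩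

variable (R) in
-- Two independent copies of `π` and a single shared uniform variable drive both sides. The
-- logarithms cancel, and what remains is the linear part applied to two independent centered
-- differences.
theorem exists_isCoupling_Psi (h : IsCoupling π μ ν) (hμ : μ ∈ M E) (hν : ν ∈ M E) :
    ∃ ρ, IsCoupling ρ (R.Psi μ) (R.Psi ν) ∧ cost ρ ≤ 81 / 100 * cost π := by
  have := h.isProbabilityMeasure
  have ms := R.measurable_step
  let f : ((E × ℝ) × (E × ℝ)) × ((E × ℝ) × (E × ℝ)) × ℝ → (E × ℝ) × (E × ℝ) := fun q =>
    (R.step (q.1.1, q.2.1.1, q.2.2), R.step (q.1.2, q.2.1.2, q.2.2))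
  have mf : Measurable f := by fun_prop
  have hfst : MeasurePreserving Prod.fst π (μ : Measure (E × ℝ)) := ⟨measurable_fst, h.1⟩
  have hsnd : MeasurePreserving Prod.snd π (ν : Measure (E × ℝ)) := ⟨measurable_snd, h.2⟩
  have hL := h.memLp_sub hμ hν
  have h0 := h.integral_sub_snd hμ hν
  have key (q) : (f q).1 - (f q).2 =
      R.combineLin (q.1.1 - q.1.2) (q.2.1.1 - q.2.1.2) 0 0 := by
    simp [f, step, combine_sub_combine]
  have hpr : MeasurePreserving (fun q : ((E × ℝ) × (E × ℝ)) × ((E × ℝ) × (E × ℝ)) × ℝ =>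
      (q.1, q.2.1)) (π.prod (π.prod unif)) (π.prod π) :=
    (MeasurePreserving.id π).prod measurePreserving_fst
  have hcl : Continuous fun q : ((E × ℝ) × (E × ℝ)) × ((E × ℝ) × (E × ℝ)) =>
      R.combineLin (q.1.1 - q.1.2) (q.2.1 - q.2.2) 0 0 :=
    R.continuous_combineLin.comp (by fun_prop : Continuous fun
      q : ((E × ℝ) × (E × ℝ)) × ((E × ℝ) × (E × ℝ)) =>
        ((q.1.1 - q.1.2), (q.2.1 - q.2.2), (0 : ℝ), (0 : ℝ)))
  have h_integral (g : E × ℝ → ℝ) (hg : Continuous g) :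
      ∫ p, g (p.1 - p.2) ∂((π.prod (π.prod unif)).map f) =
        ∫ q, g (R.combineLin (q.1.1 - q.1.2) (q.2.1 - q.2.2) 0 0) ∂(π.prod π) := by
    have h1 := integral_map (μ := π.prod (π.prod unif)) hpr.measurable.aemeasurable
      (hg.comp hcl).aestronglyMeasurable
    rw [hpr.map_eq] at h1
    rw [integral_map mf.aemeasurable (by fun_prop)]
    simp only [key]
    exact h1.symm
  refine ⟨(π.prod (π.prod unif)).map f, ⟨?_, ?_⟩, ?_⟩
  · rw [Measure.map_map measurable_fst mf]
    change Measure.map (R.step ∘ fun q : ((E × ℝ) × (E × ℝ)) × ((E × ℝ) × (E × ℝ)) × ℝ =>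
      (q.1.1, q.2.1.1, q.2.2)) _ = _
    rw [← Measure.map_map ms (by fun_prop)]
    have := (hfst.prod (hfst.prod (MeasurePreserving.id unif))).map_eq
    exact congrArg (Measure.map R.step) this
  · rw [Measure.map_map measurable_snd mf]
    change Measure.map (R.step ∘ fun q : ((E × ℝ) × (E × ℝ)) × ((E × ℝ) × (E × ℝ)) × ℝ =>
      (q.1.2, q.2.1.2, q.2.2)) _ = _
    rw [← Measure.map_map ms (by fun_prop)]
    have := (hsnd.prod (hsnd.prod (MeasurePreserving.id unif))).map_eq
    exact congrArg (Measure.map R.step) this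
  · have c1 := h_integral (fun z => ‖z.1‖ ^ 2) (by fun_prop)
    have c2 := h_integral (fun z => z.2 ^ 2) (by fun_prop)
    have b1 := R.integral_combineLin_fst_sq_le hL hL h0 h0 0 0
    have b2 := R.integral_combineLin_snd_sq hL hL h0 h0 0 0
    rw [← c1] at b1
    rw [← c2] at b2
    simp only [Prod.fst_sub, Prod.snd_sub] at b1 b2
    have m1 : ∫ p, ‖p.1.1 - p.2.1‖ ^ 2 ∂π ≤ cost π := le_max_left _ _
    have m2 : 7 * ∫ p, (p.1.2 - p.2.2) ^ 2 ∂π ≤ cost π := le_max_right _ _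
    have m0 := cost_nonneg π
    -- With `K = cost π`, the mean square difference of the second components is at most `K / 7`.
    -- The first bound is `3/4 K + 3/8 · K/7 = 45/56 K`, just below `81/100 K`; the second is `K /
    -- 2`. The value 81/100 is chosen as the square of 9/10.
    refine max_le ?_ ?_
    · linarith
    · linarith

variable (R) in
theorem wDist_Psi_le (hμ : μ ∈ M E) (hν : ν ∈ M E) :
    wDist (R.Psi μ) (R.Psi ν) ≤ 9 / 10 * wDist μ ν := by
  have h : sInf {c : ℝ | ∃ π, IsCoupling π (R.Psi μ) (R.Psi ν) ∧ c = cost π} / (81 / 100) ≤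
      sInf {c : ℝ | ∃ π, IsCoupling π μ ν ∧ c = cost π} := by
    refine le_csInf ⟨_, _, isCoupling_prod μ ν, rfl⟩ ?_
    rintro _ ⟨π, hπ, rfl⟩
    obtain ⟨ρ, hρ, hle⟩ := exists_isCoupling_Psi R hπ hμ hν
    have := csInf_le (bddBelow_cost _ _) ⟨ρ, hρ, rfl⟩
    rw [div_le_iff₀ (by norm_num)]
    linarith
  rw [div_le_iff₀ (by norm_num)] at h
  unfold wDist
  have e : (9 / 10 : ℝ) = Real.sqrt (81 / 100) := by
    rw [show (81 / 100 : ℝ) = (9 / 10) ^ 2 by norm_num, Real.sqrt_sq (by norm_num)]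
  rw [e, ← Real.sqrt_mul (by norm_num), mul_comm]
  exact Real.sqrt_le_sqrt h

theorem IsCoupling.abs_integral_sub_le (h : IsCoupling π μ ν) (hμ : μ ∈ M E) (hν : ν ∈ M E)
    {f : E × ℝ → ℝ} {C : ℝ} (hC : ∀ x y, dist (f x) (f y) ≤ C) {L : NNReal}
    (hL : LipschitzWith L f) {δ : ℝ} (hδ : 0 < δ) (hπ : cost π ≤ δ ^ 2) :
    |∫ z, f z ∂(μ : Measure (E × ℝ)) - ∫ z, f z ∂(ν : Measure (E × ℝ))| ≤ L * (3 * δ) := by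
  have := h.isProbabilityMeasure
  have hm : Measurable f := hL.continuous.measurable
  have hbd (z : E × ℝ) : ‖f z‖ ≤ ‖f 0‖ + C := by
    have := norm_sub_norm_le (f z) (f 0)
    have := hC z 0
    rw [dist_eq_norm] at this
    linarith
  have i1 : Integrable (fun p : (E × ℝ) × (E × ℝ) => f p.1) π :=
    .of_bound (hm.comp measurable_fst).aestronglyMeasurable _ (ae_of_all _ fun p => hbd p.1)
  have i2 : Integrable (fun p : (E × ℝ) × (E × ℝ) => f p.2) π :=
    .of_bound (hm.comp measurable_snd).aestronglyMeasurable _ (ae_of_all _ fun p => hbd p.2)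
  have hS := h.memLp_sub hμ hν
  have j1 := integrable_norm_fst_sq hS
  have j2 := integrable_snd_sq hS
  rw [← h.1, ← h.2, integral_map (by fun_prop) hm.aestronglyMeasurable,
    integral_map (by fun_prop) hm.aestronglyMeasurable, ← integral_sub i1 i2]
  have j3 : Integrable (fun p : (E × ℝ) × (E × ℝ) =>
      δ + δ⁻¹ * (‖(p.1 - p.2).1‖ ^ 2 + (p.1 - p.2).2 ^ 2)) π :=
    (integrable_const δ).add ((j1.add j2).const_mul _)
  have hpt (p : (E × ℝ) × (E × ℝ)) : ‖f p.1 - f p.2‖ ≤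
      L * (δ + δ⁻¹ * (‖(p.1 - p.2).1‖ ^ 2 + (p.1 - p.2).2 ^ 2)) := by
    rw [← dist_eq_norm]
    refine (hL.dist_le_mul _ _).trans (mul_le_mul_of_nonneg_left ?_ L.2)
    rw [dist_eq_norm]
    set z := p.1 - p.2
    have hz : ‖z‖ ^ 2 ≤ ‖z.1‖ ^ 2 + z.2 ^ 2 := by
      rw [Prod.norm_def, ← sq_abs z.2, ← Real.norm_eq_abs]
      rcases max_choice ‖z.1‖ ‖z.2‖ with h | h <;> rw [h] <;>
        nlinarith [sq_nonneg ‖z.1‖, sq_nonneg ‖z.2‖]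
    -- This bounds the mean norm by second moments without the Cauchy–Schwarz inequality; the mean
    -- of the right side is at most `δ + 2δ`.
    have h2 : ‖z‖ ≤ δ + δ⁻¹ * ‖z‖ ^ 2 := by
      have : ‖z‖ * δ ≤ (δ + δ⁻¹ * ‖z‖ ^ 2) * δ := by
        rw [add_mul, mul_assoc, mul_comm (‖z‖ ^ 2), ← mul_assoc, inv_mul_cancel₀ hδ.ne', one_mul]
        nlinarith [sq_nonneg (‖z‖ - δ), sq_nonneg (‖z‖), sq_nonneg δ]
      exact le_of_mul_le_mul_right this hδ
    exact h2.trans (add_le_add_right (mul_le_mul_of_nonneg_left hz (by positivity)) _)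
  refine (norm_integral_le_of_norm_le (j3.const_mul L) (ae_of_all _ hpt)).trans ?_
  rw [integral_const_mul]
  refine mul_le_mul_of_nonneg_left ?_ L.2
  have e1 := integral_add (integrable_const δ) ((j1.add j2).const_mul δ⁻¹)
  refine e1.trans_le ?_
  have e2 := integral_add j1 j2
  have m1 : ∫ p, ‖p.1.1 - p.2.1‖ ^ 2 ∂π ≤ cost π := le_max_left _ _
  have m2 : 7 * ∫ p, (p.1.2 - p.2.2) ^ 2 ∂π ≤ cost π := le_max_right _ _
  have m3 : 0 ≤ ∫ p, (p.1.2 - p.2.2) ^ 2 ∂π := integral_nonneg fun _ => sq_nonneg _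
  simp only [Prod.fst_sub, Prod.snd_sub] at e2
  simp only [integral_const, probReal_univ, one_smul, integral_const_mul, Pi.add_apply,
    Prod.fst_sub, Prod.snd_sub]
  rw [e2]
  have : δ⁻¹ * (∫ p, ‖p.1.1 - p.2.1‖ ^ 2 ∂π + ∫ p, (p.1.2 - p.2.2) ^ 2 ∂π) ≤
      δ⁻¹ * (2 * δ ^ 2) := mul_le_mul_of_nonneg_left (by linarith) (by positivity)
  have e3 : δ⁻¹ * (2 * δ ^ 2) = 2 * δ := by field_simp
  linarith

theorem eq_of_wDist_eq_zero (hμ : μ ∈ M E) (hν : ν ∈ M E) (h : wDist μ ν = 0) : μ = ν := by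
  have hinf : sInf {c : ℝ | ∃ π, IsCoupling π μ ν ∧ c = cost π} ≤ 0 := Real.sqrt_eq_zero'.1 h
  -- Weak convergence is tested by bounded Lipschitz functions, so equality of all their integrals
  -- makes the constant sequence `μ` converge to `ν`. Uniqueness of weak limits concludes.
  have key : Tendsto (fun _ : ℕ => μ) atTop (𝓝 ν) := by
    rw [tendsto_iff_forall_lipschitz_integral_tendsto]
    rintro f ⟨C, hC⟩ ⟨L, hL⟩
    have : |∫ z, f z ∂(μ : Measure (E × ℝ)) - ∫ z, f z ∂(ν : Measure (E × ℝ))| ≤ 0 := by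
      have h1 : ∀ᶠ δ in 𝓝[>] (0 : ℝ),
          |∫ z, f z ∂(μ : Measure (E × ℝ)) - ∫ z, f z ∂(ν : Measure (E × ℝ))| ≤ L * (3 * δ) := by
        filter_upwards [self_mem_nhdsWithin] with δ hδ
        have hδ' : (0 : ℝ) < δ := hδ
        obtain ⟨_, ⟨π, hπ, rfl⟩, hlt⟩ := exists_lt_of_csInf_lt
          (⟨_, _, isCoupling_prod μ ν, rfl⟩ :
            {c : ℝ | ∃ π, IsCoupling π μ ν ∧ c = cost π}.Nonempty) (hinf.trans_lt (by positivity : (0 : ℝ) < δ ^ 2))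
        exact hπ.abs_integral_sub_le hμ hν hC hL hδ hlt.le
      have h2 : Tendsto (fun δ : ℝ => L * (3 * δ)) (𝓝[>] 0) (𝓝 0) := by
        have : Tendsto (fun δ : ℝ => L * (3 * δ)) (𝓝 0) (𝓝 (L * (3 * 0))) := by
          apply Continuous.tendsto; fun_prop
        simp only [mul_zero] at this
        exact this.mono_left nhdsWithin_le_nhds
      exact ge_of_tendsto h2 h1
    rw [sub_eq_zero.1 (abs_nonpos_iff.1 this)]
    exact tendsto_const_nhds
  exact tendsto_nhds_unique tendsto_const_nhds key

variable (R) in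
theorem eq_of_Psi_eq (hμ : μ ∈ M E) (hν : ν ∈ M E) (h1 : R.Psi μ = μ) (h2 : R.Psi ν = ν) :
    μ = ν := by
  refine eq_of_wDist_eq_zero hμ hν (le_antisymm ?_ (Real.sqrt_nonneg _))
  have := wDist_Psi_le R hμ hν
  rw [h1, h2] at this
  linarith

end Operator

end AffineRec

/-! ### Independent uniform variables on the infinite binary tree -/

/-- Real labels on the nodes of the infinite binary tree. -/
abbrev Labels : Type := List Bool → ℝ

/-- The law of independent uniform labels. -/
def labelLaw : Measure Labels := Measure.infinitePi fun _ => unif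

instance : IsProbabilityMeasure labelLaw := by unfold labelLaw; infer_instance

/-- The labels of a subtree of the root. -/
def subLabels (b : Bool) (ω : Labels) : Labels := fun w => ω (b :: w)

/-- The root label and the labels of the two subtrees of the root. -/
def splitLabels (ω : Labels) : ℝ × Labels × Labels :=
  (ω [], subLabels false ω, subLabels true ω)

/-- The inverse of `splitLabels`. -/
def joinLabels (p : ℝ × Labels × Labels) : Labels
  | [] => p.1
  | false :: w => p.2.1 w
  | true :: w => p.2.2 w

theorem measurable_subLabels (b : Bool) : Measurable (subLabels b) :=
  measurable_pi_lambda _ fun w => measurable_pi_apply (b :: w)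

theorem measurable_splitLabels : Measurable splitLabels :=
  (measurable_pi_apply []).prodMk ((measurable_subLabels _).prodMk (measurable_subLabels _))

theorem measurable_joinLabels : Measurable joinLabels := by
  refine measurable_pi_lambda _ fun w => ?_
  match w with
  | [] => exact measurable_fst
  | false :: w => exact (measurable_pi_apply w).comp (measurable_fst.comp measurable_snd)
  | true :: w => exact (measurable_pi_apply w).comp (measurable_snd.comp measurable_snd)

theorem prod_words_split (s : Finset (List Bool)) (g : List Bool → ENNReal) :
    ∏ w ∈ s, g w = (if [] ∈ s then g [] else 1) *
      ((∏ w ∈ s.preimage (List.cons false) (List.cons_injective.injOn), g (false :: w)) *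
        ∏ w ∈ s.preimage (List.cons true) (List.cons_injective.injOn), g (true :: w)) := by
  classical
  rw [Finset.prod_preimage' (List.cons false) s List.cons_injective.injOn g,
    Finset.prod_preimage' (List.cons true) s List.cons_injective.injOn g]
  have h0 : (if [] ∈ s then g [] else 1) = ∏ w ∈ s with w = [], g w := by
    split_ifs with h
    · rw [Finset.prod_filter, Finset.prod_eq_single_of_mem [] h fun w _ hw => if_neg hw, if_pos rfl]
    · refine (Finset.prod_eq_one fun w hw => absurd ?_ h).symm
      rw [Finset.mem_filter] at hw
      exact hw.2 ▸ hw.1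
  rw [h0, ← Finset.prod_union, ← Finset.prod_union]
  · refine Finset.prod_congr ?_ fun _ _ => rfl
    ext w
    rcases w with _ | ⟨_ | _, w⟩ <;> simp
  · rw [Finset.disjoint_left]
    rintro w hw hw'
    rcases w with _ | ⟨_ | _, w⟩ <;> simp_all
  · rw [Finset.disjoint_left]
    rintro w hw hw'
    rcases w with _ | ⟨_ | _, w⟩ <;> simp_all

/-- An infinite product measure is determined by finite boxes. Sorting the words of a box by their
first letter, with the empty word apart, splits it into a product of three boxes. -/
theorem map_joinLabels :
    (unif.prod (labelLaw.prod labelLaw)).map joinLabels = labelLaw := by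
  refine Measure.eq_infinitePi _ fun s t ht => ?_
  rw [Measure.map_apply measurable_joinLabels
    (MeasurableSet.pi s.countable_toSet fun i _ => ht i)]
  have e : joinLabels ⁻¹' Set.pi s t =
      (if [] ∈ s then t [] else Set.univ) ×ˢ
        ((Set.pi (s.preimage (List.cons false) (List.cons_injective.injOn))
            fun w => t (false :: w)) ×ˢ
          (Set.pi (s.preimage (List.cons true) (List.cons_injective.injOn))
            fun w => t (true :: w))) := by
    ext p
    simp only [Set.mem_preimage, Set.mem_pi, Finset.mem_coe, Set.mem_prod, Finset.mem_preimage]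
    constructor
    · intro h
      refine ⟨?_, fun w hw => h _ hw, fun w hw => h _ hw⟩
      split_ifs with h0
      · exact h _ h0
      · trivial
    · rintro ⟨h0, h1, h2⟩ w hw
      rcases w with _ | ⟨_ | _, w⟩
      · rw [if_pos hw] at h0; exact h0
      · exact h1 w hw
      · exact h2 w hw
  rw [e, Measure.prod_prod, Measure.prod_prod, labelLaw, Measure.infinitePi_pi _ fun i _ => ht _,
    Measure.infinitePi_pi _ fun i _ => ht _, prod_words_split s]
  congr 1
  split_ifs <;> simp

theorem measurePreserving_splitLabels :
    MeasurePreserving splitLabels labelLaw (unif.prod (labelLaw.prod labelLaw)) := by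
  refine ⟨measurable_splitLabels, ?_⟩
  conv_lhs => rw [← map_joinLabels]
  rw [Measure.map_map measurable_splitLabels measurable_joinLabels]
  exact Measure.map_id

theorem measurePreserving_subtrees :
    MeasurePreserving (fun ω => (subLabels false ω, subLabels true ω)) labelLaw
      (labelLaw.prod labelLaw) :=
  measurePreserving_snd.comp measurePreserving_splitLabels

/-! ### The fixed point as an L² limit on the space of labels -/

namespace AffineRec

section Fixed

variable {E : Type*} [NormedAddCommGroup E] [NormedSpace ℝ E] (R : AffineRec E)
  [MeasurableSpace E] [BorelSpace E] [SecondCountableTopology E]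

/-- The recursion on random variables on the space of labels. -/
def lift (f : Labels → E × ℝ) (ω : Labels) : E × ℝ :=
  R.step (f (subLabels false ω), f (subLabels true ω), ω [])

/-- A centered square integrable random variable on the space of labels. -/
structure Centered (f : Labels → E × ℝ) : Prop where
  measurable : Measurable f
  memLp : MemLp f 2 labelLaw
  integral_snd : ∫ ω, (f ω).2 ∂labelLaw = 0

variable {R} {f g : Labels → E × ℝ}

theorem measurable_lift (hf : Measurable f) : Measurable (R.lift f) := by
  refine R.measurable_step.comp ?_
  exact (hf.comp (measurable_subLabels _)).prodMk ((hf.comp (measurable_subLabels _)).prodMk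
    (measurable_pi_apply []))

/-- The law of a random variable on the space of labels. -/
def law (hf : Measurable f) : ProbabilityMeasure (E × ℝ) :=
  ⟨labelLaw.map f, Measure.isProbabilityMeasure_map hf.aemeasurable⟩

/-- The root label plays the role of `ξ`, and `f` on the two label subtrees gives the two
independent copies. -/
theorem law_lift (hf : Measurable f) : law (measurable_lift (R := R) hf) = R.Psi (law hf) := by
  refine Subtype.ext ?_
  change labelLaw.map (R.lift f) =
    ((labelLaw.map f).prod ((labelLaw.map f).prod unif)).map R.step
  have hp : MeasurePreserving f labelLaw (labelLaw.map f) := ⟨hf, rfl⟩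
  have hpu : MeasurePreserving (fun ω => (subLabels false ω, subLabels true ω, ω []))
      labelLaw (labelLaw.prod (labelLaw.prod unif)) :=
    (MeasureTheory.measurePreserving_prodAssoc _ _ _).comp
      ((Measure.measurePreserving_swap).comp measurePreserving_splitLabels)
  have := ((hp.prod (hp.prod (MeasurePreserving.id unif))).comp hpu).map_eq
  rw [← this, Measure.map_map R.measurable_step
    ((hp.prod (hp.prod (MeasurePreserving.id unif))).comp hpu).measurable]
  rfl

theorem centered_iff_law_mem_M (hf : Measurable f) : Centered f ↔ law hf ∈ M E := by
  have h1 : MemLp (fun z : E × ℝ => z) 2 (labelLaw.map f) ↔ MemLp f 2 labelLaw :=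
    memLp_map_measure_iff measurable_id.aestronglyMeasurable hf.aemeasurable
  have h2 : ∫ z, z.2 ∂(labelLaw.map f) = ∫ ω, (f ω).2 ∂labelLaw :=
    integral_map hf.aemeasurable (by fun_prop)
  rw [mem_M_iff]
  change _ ↔ MemLp (fun z : E × ℝ => z) 2 (labelLaw.map f) ∧ ∫ z, z.2 ∂(labelLaw.map f) = 0
  rw [h1, h2]
  exact ⟨fun h => ⟨h.2, h.3⟩, fun h => ⟨hf, h.1, h.2⟩⟩

theorem Centered.lift (hf : Centered f) : Centered (R.lift f) := by
  rw [centered_iff_law_mem_M (measurable_lift hf.measurable), law_lift hf.measurable]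
  exact R.Psi_mem_M ((centered_iff_law_mem_M hf.measurable).1 hf)

/-- A weighted second moment for which the recursion is a contraction. -/
def energy (D : Labels → E × ℝ) : ℝ :=
  ∫ ω, ‖(D ω).1‖ ^ 2 ∂labelLaw + 2 * ∫ ω, (D ω).2 ^ 2 ∂labelLaw

theorem energy_nonneg (D : Labels → E × ℝ) : 0 ≤ energy D :=
  add_nonneg (integral_nonneg fun _ => sq_nonneg _)
    (mul_nonneg zero_le_two (integral_nonneg fun _ => sq_nonneg _))

theorem energy_add_le {D D' : Labels → E × ℝ} (h : MemLp D 2 labelLaw)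
    (h' : MemLp D' 2 labelLaw) :
    energy (fun ω => D ω + D' ω) ≤ 2 * energy D + 2 * energy D' := by
  have h1 : ∫ ω, ‖(D ω + D' ω).1‖ ^ 2 ∂labelLaw ≤
      2 * ∫ ω, ‖(D ω).1‖ ^ 2 ∂labelLaw + 2 * ∫ ω, ‖(D' ω).1‖ ^ 2 ∂labelLaw := by
    rw [← integral_const_mul, ← integral_const_mul, ← integral_add
      ((integrable_norm_fst_sq h).const_mul 2) ((integrable_norm_fst_sq h').const_mul 2)]
    refine integral_mono (integrable_norm_fst_sq (h.add h')) (((integrable_norm_fst_sq h).const_mul 2).add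
      ((integrable_norm_fst_sq h').const_mul 2)) fun ω => ?_
    have := norm_add_le (D ω).1 (D' ω).1
    have h3 := pow_le_pow_left₀ (norm_nonneg _) this 2
    simp only [Prod.fst_add]
    nlinarith [sq_nonneg (‖(D ω).1‖ - ‖(D' ω).1‖)]
  have h2 : ∫ ω, (D ω + D' ω).2 ^ 2 ∂labelLaw ≤
      2 * ∫ ω, (D ω).2 ^ 2 ∂labelLaw + 2 * ∫ ω, (D' ω).2 ^ 2 ∂labelLaw := by
    rw [← integral_const_mul, ← integral_const_mul, ← integral_add
      ((integrable_snd_sq h).const_mul 2) ((integrable_snd_sq h').const_mul 2)]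
    refine integral_mono (integrable_snd_sq (h.add h')) (((integrable_snd_sq h).const_mul 2).add
      ((integrable_snd_sq h').const_mul 2)) fun ω => ?_
    simp only [Prod.snd_add]
    nlinarith [sq_nonneg ((D ω).2 - (D' ω).2)]
  unfold energy
  linarith

theorem ae_eq_zero_of_energy_eq_zero {D : Labels → E × ℝ} (h : MemLp D 2 labelLaw)
    (h0 : energy D = 0) : ∀ᵐ ω ∂labelLaw, D ω = 0 := by
  have n1 : 0 ≤ ∫ ω, ‖(D ω).1‖ ^ 2 ∂labelLaw := integral_nonneg fun _ => sq_nonneg _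
  have n2 : 0 ≤ ∫ ω, (D ω).2 ^ 2 ∂labelLaw := integral_nonneg fun _ => sq_nonneg _
  unfold energy at h0
  have z1 : ∫ ω, ‖(D ω).1‖ ^ 2 ∂labelLaw = 0 := by linarith
  have z2 : ∫ ω, (D ω).2 ^ 2 ∂labelLaw = 0 := by linarith
  rw [integral_eq_zero_iff_of_nonneg (fun _ => sq_nonneg _) (integrable_norm_fst_sq h)] at z1
  rw [integral_eq_zero_iff_of_nonneg (fun _ => sq_nonneg _) (integrable_snd_sq h)] at z2
  filter_upwards [z1, z2] with ω h1 h2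
  ext1
  · simpa using h1
  · simpa using h2

theorem Centered.sub_memLp (hf : Centered f) (hg : Centered g) :
    MemLp (fun ω => f ω - g ω) 2 labelLaw :=
  hf.memLp.sub hg.memLp

theorem Centered.integral_sub_snd (hf : Centered f) (hg : Centered g) :
    ∫ ω, (f ω - g ω).2 ∂labelLaw = 0 := by
  simp only [Prod.snd_sub]
  rw [integral_sub ((memLp_snd hf.memLp).integrable (by norm_num))
    ((memLp_snd hg.memLp).integrable (by norm_num)), hf.integral_snd, hg.integral_snd, sub_zero]

/-- With `a` and `b` the mean squares of the two components, the new energy is at most `3/4 a + 3/8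
b + 2 · b/2`, and `11/8 b ≤ 3/4 · 2b`. A sum is used here, and not the maximum in `cost`, because it
compares directly with the L² norm. -/
theorem energy_lift_sub_lift_le (hf : Centered f) (hg : Centered g) :
    energy (fun ω => R.lift f ω - R.lift g ω) ≤ 3 / 4 * energy fun ω => f ω - g ω := by
  have hD := hf.sub_memLp hg
  have h0 := hf.integral_sub_snd hg
  have key (ω) : R.lift f ω - R.lift g ω =
      R.combineLin (f (subLabels false ω) - g (subLabels false ω))
        (f (subLabels true ω) - g (subLabels true ω)) 0 0 := by
    simp [AffineRec.lift, step, combine_sub_combine]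
  have hm := (R.memLp_combineLin_prod hD hD 0 0).1
  have hmp := measurePreserving_subtrees
  rw [← hmp.map_eq] at hm
  have e1 := integral_map hmp.measurable.aemeasurable
    ((continuous_fst.norm.pow 2).comp_aestronglyMeasurable hm)
  have e2 := integral_map hmp.measurable.aemeasurable
    ((continuous_snd.pow 2).comp_aestronglyMeasurable hm)
  rw [hmp.map_eq] at e1 e2
  have b1 := R.integral_combineLin_fst_sq_le hD hD h0 h0 0 0
  have b2 := R.integral_combineLin_snd_sq hD hD h0 h0 0 0
  have n2 : 0 ≤ ∫ ω, (f ω - g ω).2 ^ 2 ∂labelLaw := integral_nonneg fun _ => sq_nonneg _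
  unfold energy
  simp only [key]
  have e1' := e1.symm.trans_le b1
  have e2' := e2.symm.trans b2
  simp only [Pi.pow_apply] at e1' e2'
  linarith

theorem integral_norm_sq_eq {D : Labels → E × ℝ} (h : MemLp D 2 labelLaw) :
    ‖h.toLp D‖ ^ 2 = ∫ ω, ‖D ω‖ ^ 2 ∂labelLaw := by
  rw [Lp.norm_toLp, h.eLpNorm_eq_integral_rpow_norm two_ne_zero ENNReal.ofNat_ne_top,
    ENNReal.toReal_ofReal (by positivity), ← Real.rpow_natCast, ← Real.rpow_mul (by positivity)]
  simp

theorem norm_toLp_sq_le_energy {D : Labels → E × ℝ} (h : MemLp D 2 labelLaw) :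
    ‖h.toLp D‖ ^ 2 ≤ energy D := by
  have n2 : 0 ≤ ∫ ω, (D ω).2 ^ 2 ∂labelLaw := integral_nonneg fun _ => sq_nonneg _
  have : ∫ ω, ‖D ω‖ ^ 2 ∂labelLaw ≤
      ∫ ω, ‖(D ω).1‖ ^ 2 ∂labelLaw + ∫ ω, (D ω).2 ^ 2 ∂labelLaw := by
    rw [← integral_add (integrable_norm_fst_sq h) (integrable_snd_sq h)]
    refine integral_mono (h.integrable_norm_pow (by norm_num))
      ((integrable_norm_fst_sq h).add (integrable_snd_sq h)) fun ω => ?_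
    simp only [Prod.norm_def]
    rw [← sq_abs (D ω).2, ← Real.norm_eq_abs]
    rcases max_choice ‖(D ω).1‖ ‖(D ω).2‖ with h | h <;> rw [h] <;>
      nlinarith [sq_nonneg ‖(D ω).1‖, sq_nonneg ‖(D ω).2‖]
  rw [integral_norm_sq_eq h]
  unfold energy
  linarith

theorem energy_le_norm_toLp_sq {D : Labels → E × ℝ} (h : MemLp D 2 labelLaw) :
    energy D ≤ 3 * ‖h.toLp D‖ ^ 2 := by
  have i := h.integrable_norm_pow (p := 2) (by norm_num)
  have h1 : ∫ ω, ‖(D ω).1‖ ^ 2 ∂labelLaw ≤ ∫ ω, ‖D ω‖ ^ 2 ∂labelLaw :=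
    integral_mono (integrable_norm_fst_sq h) i fun ω =>
      pow_le_pow_left₀ (norm_nonneg _) (norm_fst_le _) 2
  have h2 : ∫ ω, (D ω).2 ^ 2 ∂labelLaw ≤ ∫ ω, ‖D ω‖ ^ 2 ∂labelLaw :=
    integral_mono (integrable_snd_sq h) i fun ω => by
      have := pow_le_pow_left₀ (norm_nonneg _) (norm_snd_le (D ω)) 2
      rwa [Real.norm_eq_abs, sq_abs] at this
  rw [integral_norm_sq_eq h]
  unfold energy
  linarith

/-- Nonnegativity of the variance; it carries the centering of the iterates over to their limit. -/
theorem sq_integral_snd_le_energy {D : Labels → E × ℝ} (h : MemLp D 2 labelLaw) :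
    (∫ ω, (D ω).2 ∂labelLaw) ^ 2 ≤ energy D := by
  have h1 := variance_nonneg (fun ω => (D ω).2) labelLaw
  rw [variance_eq_sub (memLp_snd h)] at h1
  have n1 : 0 ≤ ∫ ω, ‖(D ω).1‖ ^ 2 ∂labelLaw := integral_nonneg fun _ => sq_nonneg _
  have n2 : 0 ≤ ∫ ω, (D ω).2 ^ 2 ∂labelLaw := integral_nonneg fun _ => sq_nonneg _
  simp only [Pi.pow_apply] at h1
  unfold energy
  linarith

variable (R) in
/-- The iterates of the recursion, started at `0`. -/
def iter : ℕ → Labels → E × ℝ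
  | 0 => fun _ => 0
  | n + 1 => R.lift (iter n)

variable (R) in
theorem centered_iter (n : ℕ) : Centered (R.iter n) := by
  induction n with
  | zero => exact ⟨measurable_const, MemLp.zero, by simp [iter]⟩
  | succ n ih => exact ih.lift

variable (R) in
theorem energy_iter_sub_le (n : ℕ) :
    energy (fun ω => R.iter (n + 1) ω - R.iter n ω) ≤
      (3 / 4) ^ n * energy fun ω => R.iter 1 ω - R.iter 0 ω := by
  induction n with
  | zero => simp
  | succ n ih =>
    refine (energy_lift_sub_lift_le (R.centered_iter (n + 1)) (R.centered_iter n)).trans ?_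
    rw [pow_succ']
    linarith

variable (R) in
-- The energy is equivalent to the squared L² norm, so consecutive iterates are at geometrically
-- decreasing distance of ratio `√(3/4)`, and L² is complete.
theorem exists_tendsto_energy_iter [CompleteSpace E] :
    ∃ Z : Labels → E × ℝ, Measurable Z ∧ MemLp Z 2 labelLaw ∧
      Tendsto (fun n => energy fun ω => R.iter n ω - Z ω) atTop (𝓝 0) := by
  have hL (n : ℕ) := (R.centered_iter n).memLp
  set C := Real.sqrt (energy fun ω => R.iter 1 ω - R.iter 0 ω)
  have hC : 0 ≤ C := Real.sqrt_nonneg _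
  have hdist (n : ℕ) : dist ((hL n).toLp _) ((hL (n + 1)).toLp _) ≤ C * Real.sqrt (3 / 4) ^ n := by
    rw [dist_comm, dist_eq_norm, ← MemLp.toLp_sub]
    refine le_of_sq_le_sq ?_ (by positivity)
    refine (norm_toLp_sq_le_energy _).trans ((R.energy_iter_sub_le n).trans_eq ?_)
    rw [mul_pow, Real.sq_sqrt (energy_nonneg _), ← pow_mul, mul_comm n, pow_mul,
      Real.sq_sqrt (by norm_num), mul_comm]
  have hcau := cauchySeq_of_le_geometric (Real.sqrt (3 / 4)) C
    (by rw [Real.sqrt_lt' one_pos]; norm_num) hdist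
  obtain ⟨Z, hZ⟩ := cauchySeq_tendsto_of_complete hcau
  refine ⟨Z, (Lp.stronglyMeasurable Z).measurable, Lp.memLp Z, ?_⟩
  have h0 : Tendsto (fun n => 3 * ‖(hL n).toLp _ - Z‖ ^ 2) atTop (𝓝 0) := by
    have := ((tendsto_iff_norm_sub_tendsto_zero.1 hZ).pow 2).const_mul 3
    simpa using this
  refine squeeze_zero (fun n => energy_nonneg _) (fun n => ?_) h0
  have h := energy_le_norm_toLp_sq ((hL n).sub (Lp.memLp Z))
  rw [MemLp.toLp_sub (hL n) (Lp.memLp Z), Lp.toLp_coeFn] at h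
  exact h

variable (R) in
theorem exists_centered_lift_eq [CompleteSpace E] :
    ∃ Z : Labels → E × ℝ, Centered Z ∧ ∀ᵐ ω ∂labelLaw, R.lift Z ω = Z ω := by
  obtain ⟨Z, hm, hL, ht⟩ := R.exists_tendsto_energy_iter
  have h0 : ∫ ω, (Z ω).2 ∂labelLaw = 0 := by
    have hle (n : ℕ) : (∫ ω, (Z ω).2 ∂labelLaw) ^ 2 ≤ energy fun ω => R.iter n ω - Z ω := by
      have hn := R.centered_iter n
      refine le_trans (le_of_eq ?_) (sq_integral_snd_le_energy (hn.memLp.sub hL))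
      simp only [Prod.snd_sub]
      rw [integral_sub ((memLp_snd hn.memLp).integrable (by norm_num))
        ((memLp_snd hL).integrable (by norm_num)), hn.integral_snd, zero_sub, neg_sq]
    have := ge_of_tendsto' ht hle
    exact pow_eq_zero_iff two_ne_zero |>.1 (le_antisymm this (sq_nonneg _))
  have hZ : Centered Z := ⟨hm, hL, h0⟩
  refine ⟨Z, hZ, ?_⟩
  -- The iterate of index `n + 1` is inserted between the two terms; it is the lift of the iterate
  -- of index `n`, so the first difference is controlled by the contraction.
  have hle (n : ℕ) : energy (fun ω => R.lift Z ω - Z ω) ≤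
      2 * (3 / 4 * energy fun ω => R.iter n ω - Z ω) +
        2 * energy fun ω => R.iter (n + 1) ω - Z ω := by
    have e1 := energy_add_le ((hZ.lift (R := R)).sub_memLp (R.centered_iter (n + 1)))
      ((R.centered_iter (n + 1)).sub_memLp hZ)
    simp only [sub_add_sub_cancel] at e1
    have e2 := energy_lift_sub_lift_le (R := R) hZ (R.centered_iter n)
    have e3 : (energy fun ω => Z ω - R.iter n ω) = energy fun ω => R.iter n ω - Z ω := by
      simp only [energy, Prod.fst_sub, Prod.snd_sub, fun ω => norm_sub_rev (Z ω).1,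
        fun ω => sub_sq_comm (Z ω).2]
    rw [e3] at e2
    exact e1.trans (by gcongr; exact e2)
  have hlim : Tendsto (fun n => 2 * (3 / 4 * energy fun ω => R.iter n ω - Z ω) +
        2 * energy fun ω => R.iter (n + 1) ω - Z ω) atTop (𝓝 0) := by
    have := ((ht.const_mul (3 / 4)).const_mul 2).add
      ((ht.comp (tendsto_add_atTop_nat 1)).const_mul 2)
    simpa using this
  have hz := ae_eq_zero_of_energy_eq_zero ((hZ.lift (R := R)).sub_memLp hZ)
    (le_antisymm (ge_of_tendsto' hlim hle) (energy_nonneg _))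
  filter_upwards [hz] with ω h
  exact sub_eq_zero.1 h

theorem Psi_law_eq {Z : Labels → E × ℝ} (hZ : Measurable Z)
    (h : ∀ᵐ ω ∂labelLaw, R.lift Z ω = Z ω) : R.Psi (law hZ) = law hZ := by
  rw [← law_lift]
  exact Subtype.ext (Measure.map_congr h)

end Fixed

end AffineRec

/-! ### The recursion on `C₀₀[0, 1]` -/

theorem abs_apply_le_norm (f : C00) (t : unitInterval) : |f.1 t| ≤ ‖f‖ :=
  f.1.norm_coe_le_norm t

theorem norm_le_of_forall_abs_le {f : C00} {C : ℝ} (hC : 0 ≤ C) (h : ∀ t, |f.1 t| ≤ C) :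
    ‖f‖ ≤ C :=
  (ContinuousMap.norm_le f.1 hC).2 h

theorem opA_add_opB_add_apply (x y : C00) (c : ℝ) (t : unitInterval) :
    (opA x + opB y + c • phi).1 t =
      1 / 2 * x.1 ⟨min (2 * (t : ℝ)) 1, le_min (by linarith [t.2.1]) zero_le_one,
        min_le_right _ _⟩ +
      1 / 2 * y.1 ⟨max (2 * (t : ℝ) - 1) 0, le_max_right _ _,
        max_le (by linarith [t.2.2]) zero_le_one⟩ +
      c * (1 / 2 * min (t : ℝ) (1 - t)) := rfl

/-- The functions vanish at both ends, so `opA x` lives on `[0, 1/2]` and `opB y` on `[1/2, 1]`. At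
each point at most one of them is nonzero, which gives a maximum and not a sum; `phi` is at most
1/4. -/
theorem abs_opA_add_opB_add_le (x y : C00) (c : ℝ) (t : unitInterval) :
    |(opA x + opB y + c • phi).1 t| ≤ 1 / 2 * max ‖x‖ ‖y‖ + 1 / 4 * |c| := by
  rw [opA_add_opB_add_apply]
  have hphi : |c * (1 / 2 * min (t : ℝ) (1 - t))| ≤ 1 / 4 * |c| := by
    have h1 : min (t : ℝ) (1 - t) ≤ 1 / 2 := by
      rcases le_total (t : ℝ) (1 / 2) with h | h
      · exact (min_le_left _ _).trans h
      · exact (min_le_right _ _).trans (by linarith)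
    have h0 : 0 ≤ min (t : ℝ) (1 - t) := le_min t.2.1 (by linarith [t.2.2])
    rw [abs_mul, abs_of_nonneg (by positivity : 0 ≤ 1 / 2 * min (t : ℝ) (1 - t))]
    nlinarith [abs_nonneg c]
  refine (abs_add_le _ _).trans (add_le_add ?_ hphi)
  have half (x : ℝ) : |1 / 2 * x| = 1 / 2 * |x| := by rw [abs_mul]; norm_num
  rcases le_total (t : ℝ) (1 / 2) with h | h
  · have : (⟨max (2 * (t : ℝ) - 1) 0, le_max_right _ _,
        max_le (by linarith [t.2.2]) zero_le_one⟩ : unitInterval) = 0 :=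
      Subtype.ext (max_eq_right (by linarith))
    rw [this, y.2.1, mul_zero, add_zero, half]
    exact mul_le_mul_of_nonneg_left
      ((abs_apply_le_norm _ _).trans (le_max_left _ _)) (by norm_num)
  · have : (⟨min (2 * (t : ℝ)) 1, le_min (by linarith [t.2.1]) zero_le_one,
        min_le_right _ _⟩ : unitInterval) = 1 :=
      Subtype.ext (min_eq_right (by linarith))
    rw [this, x.2.2, mul_zero, zero_add, half]
    exact mul_le_mul_of_nonneg_left
      ((abs_apply_le_norm _ _).trans (le_max_right _ _)) (by norm_num)

/-- With `m` the maximum, `(m/2 + |c|/4)² = m²/4 + m|c|/4 + c²/16`, and `m|c| ≤ (m² + c²)/2` yields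
`3/8 m² + 3/16 c²`. -/
theorem sq_half_max_add_le {x y r c : ℝ} (hr : 0 ≤ r)
    (h : r ≤ 1 / 2 * max x y + 1 / 4 * |c|) :
    r ^ 2 ≤ 3 / 8 * (x ^ 2 + y ^ 2) + 3 / 16 * c ^ 2 := by
  have hmax : max x y ^ 2 ≤ x ^ 2 + y ^ 2 := by
    rcases max_choice x y with h | h <;> rw [h] <;> nlinarith [sq_nonneg x, sq_nonneg y]
  have h2 := pow_le_pow_left₀ hr h 2
  have hcc : |c| ^ 2 = c ^ 2 := sq_abs c
  nlinarith [sq_nonneg (max x y - |c|)]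

/-- The recursion that defines `Ψ`. -/
def silhouetteRec : AffineRec C00 where
  A := ⟨opA, AddMonoidHomClass.continuous_of_bound opA 1 norm_opA_le⟩
  B := ⟨opB, AddMonoidHomClass.continuous_of_bound opB 1 norm_opB_le⟩
  φ := phi
  norm_sq_le x y c := by
    refine sq_half_max_add_le (norm_nonneg _) ?_
    refine norm_le_of_forall_abs_le ?_ (abs_opA_add_opB_add_le x y c)
    have := norm_nonneg x
    positivity

theorem isClosed_C00Submodule : IsClosed (C00Submodule : Set C(unitInterval, ℝ)) := by
  have h (t : unitInterval) : IsClosed {f : C(unitInterval, ℝ) | f t = 0} :=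
    isClosed_eq (continuous_eval_const t) continuous_const
  exact (h 0).inter (h 1)

theorem completeSpace_C00 : CompleteSpace C00 :=
  isClosed_C00Submodule.completeSpace_coe

/-! ### Unlabeled trees -/

/-- The word set of an unlabeled tree. -/
def toBinTree (t : BinaryTree Unit) : BinTree :=
  ⟨addresses (t.map fun _ => 0), addresses_prefix _⟩

/-- The unlabeled tree below a labeled tree. -/
def shape (t : BinaryTree ℝ) : BinaryTree Unit := t.map fun _ => ()

theorem addresses_map_shape (t : BinaryTree ℝ) :
    addresses ((shape t).map fun _ => 0) = addresses t := by
  induction t with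
  | nil => rfl
  | node a l r ihl ihr =>
    simp only [shape] at ihl ihr
    simp only [shape, BinaryTree.map, addresses, ihl, ihr]

theorem bst_eq_toBinTree (x : ℕ → ℝ) (n : ℕ) :
    bst x n = toBinTree (shape (bstLabeled x n)) := by
  simp only [bst, toBinTree, addresses_map_shape]

theorem toBinTree_node_nodes (l r : BinaryTree Unit) :
    (toBinTree (.node () l r)).nodes = insert []
      ((toBinTree l).nodes.image (List.cons false) ∪ (toBinTree r).nodes.image (List.cons true)) :=
  rfl

theorem size_toBinTree (t : BinaryTree Unit) : (toBinTree t).size = t.numNodes := by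
  induction t with
  | nil => rfl
  | node a l r ihl ihr =>
    rw [BinTree.size, toBinTree_node_nodes, Finset.card_insert_of_notMem (by simp),
      Finset.card_union_of_disjoint, Finset.card_image_of_injective _ List.cons_injective,
      Finset.card_image_of_injective _ List.cons_injective]
    · rw [BinTree.size] at ihl ihr
      rw [ihl, ihr, BinaryTree.numNodes]
    · rw [Finset.disjoint_left]
      intro w h1 h2
      simp only [Finset.mem_image] at h1 h2
      obtain ⟨_, _, rfl⟩ := h1
      obtain ⟨_, _, h⟩ := h2
      simp at h

/-! ### The silhouette of a tree in terms of its subtrees -/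

theorem binWord_succ (s : ℝ) (k : ℕ) :
    binWord s (k + 1) = binDigit s 0 :: (List.range k).map fun i => binDigit s (i + 1) := by
  simp [binWord, List.range_succ_eq_map, Function.comp_def]

theorem binDigit_succ_of_lt {s : ℝ} (h : s < 1 / 2) (i : ℕ) :
    binDigit s (i + 1) = binDigit (2 * s) i := by
  have h1 : s ≠ 1 := by linarith
  have h2 : 2 * s ≠ 1 := by linarith
  simp only [binDigit, if_neg h1, if_neg h2]
  rw [show (2 : ℝ) ^ (i + 1 + 1) * s = 2 ^ (i + 1) * (2 * s) by ring]

/-- Subtracting 1 after doubling changes the integer part by the even number `2 ^ (i + 1)`, which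
leaves its parity unchanged. The convention at 1 is consistent because 1 is fixed by `s ↦ 2s - 1`.
-/
theorem binDigit_succ_of_le {s : ℝ} (i : ℕ) :
    binDigit s (i + 1) = binDigit (2 * s - 1) i := by
  by_cases hs : s = 1
  · have : 2 * s - 1 = 1 := by linarith
    simp only [binDigit, if_pos hs, if_pos this]
  · have : 2 * s - 1 ≠ 1 := fun h => hs (by linarith)
    simp only [binDigit, if_neg hs, if_neg this]
    rw [show (2 : ℝ) ^ (i + 1) * (2 * s - 1) = 2 ^ (i + 1 + 1) * s - ((2 ^ (i + 1) : ℤ) : ℝ) by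
      push_cast; ring, Int.floor_sub_intCast]
    have h2 : (2 : ℤ) ∣ 2 ^ (i + 1) := dvd_pow_self 2 (by omega)
    congr 1
    exact propext (by omega)

theorem binDigit_zero_of_lt {s : ℝ} (h0 : 0 ≤ s) (h : s < 1 / 2) : binDigit s 0 = false := by
  have h1 : s ≠ 1 := by linarith
  have : ⌊(2 : ℝ) ^ (0 + 1) * s⌋ = 0 := by
    rw [Int.floor_eq_zero_iff]
    constructor <;> norm_num <;> linarith
  simp only [binDigit, if_neg h1, this]
  rfl

theorem binDigit_zero_of_le {s : ℝ} (h0 : 1 / 2 ≤ s) (h : s ≤ 1) : binDigit s 0 = true := by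
  by_cases hs : s = 1
  · simp [binDigit, hs]
  · have h1 : s < 1 := lt_of_le_of_ne h hs
    have : ⌊(2 : ℝ) ^ (0 + 1) * s⌋ = 1 := by
      rw [Int.floor_eq_iff]
      constructor <;> norm_num <;> linarith
    simp only [binDigit, if_neg hs, this]
    rfl

/-- Passing the root costs one step. Nonemptiness of `q` matters because `sInf ∅ = 0` in `ℕ`. -/
theorem sInf_eq_sInf_add_one {p q : Set ℕ} (h0 : 0 ∉ p) (h : ∀ k, k + 1 ∈ p ↔ k ∈ q)
    (hq : q.Nonempty) : sInf p = sInf q + 1 := by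
  have hp : p.Nonempty := hq.imp' (· + 1) fun k hk => (h k).2 hk
  refine le_antisymm (Nat.sInf_le ((h _).2 (Nat.sInf_mem hq))) ?_
  have hm := Nat.sInf_mem hp
  rcases hk : sInf p with _ | k
  · rw [hk] at hm; exact absurd hm h0
  · rw [hk] at hm
    exact Nat.succ_le_succ (Nat.sInf_le ((h k).1 hm))

theorem silhouette_set_nonempty (T : BinTree) (s : ℝ) :
    {k : ℕ | binWord s k ∉ T.nodes}.Nonempty := by
  obtain ⟨K, hK⟩ := exists_bound T
  exact ⟨K, hK _ (binWord_length s K).ge⟩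

theorem silhouette_node_of_lt (l r : BinaryTree Unit) {s : ℝ} (h0 : 0 ≤ s) (h : s < 1 / 2) :
    silhouette (toBinTree (.node () l r)) s = silhouette (toBinTree l) (2 * s) + 1 := by
  refine sInf_eq_sInf_add_one ?_ (fun k => ?_) (silhouette_set_nonempty _ _)
  · simp [toBinTree_node_nodes, binWord]
  · simp only [Set.mem_ofPred_eq]
    rw [binWord_succ, binDigit_zero_of_lt h0 h, toBinTree_node_nodes]
    simp only [fun i => binDigit_succ_of_lt h i]
    simp [binWord]

theorem silhouette_node_of_le (l r : BinaryTree Unit) {s : ℝ} (h0 : 1 / 2 ≤ s) (h : s ≤ 1) :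
    silhouette (toBinTree (.node () l r)) s = silhouette (toBinTree r) (2 * s - 1) + 1 := by
  refine sInf_eq_sInf_add_one ?_ (fun k => ?_) (silhouette_set_nonempty _ _)
  · simp [toBinTree_node_nodes, binWord]
  · simp only [Set.mem_ofPred_eq]
    rw [binWord_succ, binDigit_zero_of_le h0 h, toBinTree_node_nodes]
    simp only [fun i => binDigit_succ_of_le (s := s) i]
    simp [binWord]

theorem intSilhouette_node_of_le_half (l r : BinaryTree Unit) {t : ℝ} (h0 : 0 ≤ t)
    (h : t ≤ 1 / 2) :
    intSilhouette (toBinTree (.node () l r)) t = t + 1 / 2 * intSilhouette (toBinTree l) (2 * t) := by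
  have e : intSilhouette (toBinTree (.node () l r)) t =
      ∫ s in (0 : ℝ)..t, ((silhouette (toBinTree l) (2 * s) : ℝ) + 1) := by
    refine intervalIntegral.integral_congr_Ioo_of_le h0 fun s hs => ?_
    simp only [silhouette_node_of_lt l r hs.1.le (hs.2.trans_le h)]
    push_cast; rfl
  have hi := (intervalIntegrable_silhouette (toBinTree l) 0 (2 * t)).comp_mul_left (c := 2)
  rw [e, intervalIntegral.integral_add (by simpa using hi) (by simp),
    intervalIntegral.integral_comp_mul_left (fun s => (silhouette (toBinTree l) s : ℝ)) two_ne_zero]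
  simp [intSilhouette]
  ring

theorem intSilhouette_node_of_half_le (l r : BinaryTree Unit) {t : ℝ} (h0 : 1 / 2 ≤ t)
    (h : t ≤ 1) :
    intSilhouette (toBinTree (.node () l r)) t = t + 1 / 2 * intSilhouette (toBinTree l) 1 +
      1 / 2 * intSilhouette (toBinTree r) (2 * t - 1) := by
  have e : ∫ s in (1 / 2 : ℝ)..t, (silhouette (toBinTree (.node () l r)) s : ℝ) =
      ∫ s in (1 / 2 : ℝ)..t, ((silhouette (toBinTree r) (2 * s - 1) : ℝ) + 1) := by
    refine intervalIntegral.integral_congr_Ioo_of_le h0 fun s hs => ?_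
    simp only [silhouette_node_of_le l r hs.1.le (hs.2.le.trans h)]
    push_cast; rfl
  have hi : IntervalIntegrable (fun s => (silhouette (toBinTree r) (2 * s - 1) : ℝ)) volume
      (1 / 2) t := by
    obtain ⟨K, hK⟩ := silhouette_bounded (toBinTree r)
    refine (intervalIntegrable_const (c := (K : ℝ))).mono_fun'
      (measurable_from_top.comp ((measurable_silhouette _).comp
        (by fun_prop : Measurable fun s : ℝ => 2 * s - 1))).aestronglyMeasurable
      (Eventually.of_forall fun s => ?_)
    simpa using hK (2 * s - 1)
  have e2 : intSilhouette (toBinTree (.node () l r)) t =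
      intSilhouette (toBinTree (.node () l r)) (1 / 2) +
        ∫ s in (1 / 2 : ℝ)..t, (silhouette (toBinTree (.node () l r)) s : ℝ) :=
    (intervalIntegral.integral_add_adjacent_intervals
      (intervalIntegrable_silhouette _ _ _) (intervalIntegrable_silhouette _ _ _)).symm
  rw [e2, e, intSilhouette_node_of_le_half l r (by norm_num) le_rfl,
    intervalIntegral.integral_add hi (by simp),
    intervalIntegral.integral_comp_mul_sub (fun s => (silhouette (toBinTree r) s : ℝ)) two_ne_zero]
  simp [intSilhouette]
  ring

theorem pathLength_node (l r : BinaryTree Unit) :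
    pathLength (toBinTree (.node () l r)) =
      1 + 1 / 2 * (pathLength (toBinTree l) + pathLength (toBinTree r)) := by
  have h := intSilhouette_node_of_half_le l r (t := 1) (by norm_num) le_rfl
  norm_num at h
  change intSilhouette _ 1 = 1 + 1 / 2 * (intSilhouette _ 1 + intSilhouette _ 1)
  rw [h]
  ring

/-- The pair `(Y°, η°)` of an unlabeled tree. -/
def shapePair (t : BinaryTree Unit) : S := pair (toBinTree t)

/-- The harmonic numbers as real numbers. -/
def harm (n : ℕ) : ℝ := (harmonic n : ℝ)

theorem shapePair_nil : shapePair .nil = 0 := by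
  have hs (s : ℝ) : silhouette (toBinTree .nil) s = 0 :=
    Nat.sInf_eq_zero.2 (Or.inl (by simp [toBinTree, addresses, BinaryTree.map]))
  have hi (t : ℝ) : intSilhouette (toBinTree .nil) t = 0 := by simp [intSilhouette, hs]
  have hp : pathLength (toBinTree .nil) = 0 := hi 1
  ext1
  · refine Subtype.ext (ContinuousMap.ext fun t => ?_)
    change intSilhouette _ _ - _ * intSilhouette _ 1 = 0
    simp [hi]
  · change pathLength _ - _ = 0
    rw [hp, size_toBinTree]
    simp

/-- In the first component the harmonic number of the full size cancels, and the coefficient of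
`phi` is the uncentered difference of path lengths of the subtrees. In the second component the
harmonic numbers merely account for the three centerings. -/
theorem shapePair_node (l r : BinaryTree Unit) :
    shapePair (.node () l r) = silhouetteRec.combine (shapePair l) (shapePair r)
      (harm l.numNodes - harm (l.numNodes + r.numNodes + 1))
      (harm r.numNodes - harm (l.numNodes + r.numNodes + 1)) := by
  have hη (t : BinaryTree Unit) : (shapePair t).2 = pathLength (toBinTree t) - harm t.numNodes := by
    rw [← size_toBinTree]; rfl
  ext1
  · refine Subtype.ext (ContinuousMap.ext fun t => ?_)
    have hc : ((silhouetteRec.combine (shapePair l) (shapePair r)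
        (harm l.numNodes - harm (l.numNodes + r.numNodes + 1))
        (harm r.numNodes - harm (l.numNodes + r.numNodes + 1))).1.1) t =
      1 / 2 * (intSilhouette (toBinTree l) (min (2 * (t : ℝ)) 1) -
        min (2 * (t : ℝ)) 1 * pathLength (toBinTree l)) +
      1 / 2 * (intSilhouette (toBinTree r) (max (2 * (t : ℝ) - 1) 0) -
        max (2 * (t : ℝ) - 1) 0 * pathLength (toBinTree r)) +
      ((shapePair l).2 - (shapePair r).2) * (1 / 2 * min (t : ℝ) (1 - t)) +
      (harm l.numNodes - harm (l.numNodes + r.numNodes + 1) -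
        (harm r.numNodes - harm (l.numNodes + r.numNodes + 1))) *
          (1 / 2 * min (t : ℝ) (1 - t)) := rfl
    rw [hc, hη, hη]
    change intSilhouette _ t - t * pathLength _ = _
    rw [pathLength_node]
    have z0 (T : BinTree) : intSilhouette T 0 = 0 := by simp [intSilhouette]
    have z1 (T : BinTree) : intSilhouette T 1 = pathLength T := rfl
    rcases le_total (t : ℝ) (1 / 2) with h | h
    · rw [intSilhouette_node_of_le_half l r t.2.1 h, min_eq_left (by linarith),
        max_eq_right (by linarith), min_eq_left (by linarith), z0]
      ring
    · rw [intSilhouette_node_of_half_le l r h t.2.2, min_eq_right (by linarith),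
        max_eq_left (by linarith), min_eq_right (by linarith), z1]
      ring
  · rw [hη]
    change _ = 1 + 1 / 2 * ((shapePair l).2 + (shapePair r).2) + 1 / 2 * (_ + _)
    rw [hη, hη, pathLength_node, BinaryTree.numNodes]
    ring

/-! ### Discretization of a uniform variable -/

/-- The size of the left subtree of a random tree with `n + 1` nodes, as a function of a uniform
variable. -/
def cut (n : ℕ) (u : ℝ) : ℕ := min ⌊((n : ℝ) + 1) * u⌋₊ n

theorem cut_le (n : ℕ) (u : ℝ) : cut n u ≤ n := min_le_right _ _

theorem measurable_cut (n : ℕ) : Measurable (cut n) := by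
  unfold cut
  exact (Nat.measurable_floor.comp (by fun_prop)).min measurable_const

/-- The truncation in `cut` can only act at `u ≥ 1`, hence on a null set for `unif`. -/
theorem cut_eq_floor {n : ℕ} {u : ℝ} (h1 : u < 1) :
    cut n u = ⌊((n : ℝ) + 1) * u⌋₊ := by
  refine min_eq_left ?_
  refine Nat.lt_succ_iff.1 ((Nat.floor_lt' (Nat.succ_ne_zero n)).2 ?_)
  push_cast
  nlinarith

theorem measurableSet_cut_eq (n i : ℕ) : MeasurableSet {u | cut n u = i} :=
  measurable_cut n (measurableSet_singleton i)

theorem unif_cut_eq {n i : ℕ} (hi : i ≤ n) :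
    unif {u | cut n u = i} = ENNReal.ofReal (1 / (n + 1)) := by
  have hn : (0 : ℝ) < (n : ℝ) + 1 := by positivity
  have hms := measurableSet_cut_eq n i
  have hin : (i : ℝ) ≤ n := by exact_mod_cast hi
  have e : (({u | cut n u = i} ∩ Set.Icc 0 1 : Set ℝ)) =ᵐ[volume]
      Set.Ico ((i : ℝ) / (n + 1)) (((i : ℝ) + 1) / (n + 1)) := by
    have h1 : ∀ᵐ u : ℝ, u ≠ 1 := by simp [ae_iff]
    filter_upwards [h1] with u hu
    refine propext ⟨?_, ?_⟩
    · rintro ⟨h, h0, h1⟩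
      have h : cut n u = i := h
      rw [cut_eq_floor (lt_of_le_of_ne h1 hu), Nat.floor_eq_iff (by positivity)] at h
      exact ⟨by rw [div_le_iff₀ hn]; linarith, by rw [lt_div_iff₀ hn]; linarith⟩
    · rintro ⟨ha, hb⟩
      have h0 : 0 ≤ u := le_trans (by positivity) ha
      have h1 : u < 1 := hb.trans_le (by rw [div_le_one hn]; linarith)
      refine ⟨?_, h0, h1.le⟩
      change cut n u = i
      rw [cut_eq_floor h1, Nat.floor_eq_iff (by positivity)]
      rw [div_le_iff₀ hn] at ha
      rw [lt_div_iff₀ hn] at hb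
      exact ⟨by linarith, by linarith⟩
  rw [unif, Measure.restrict_apply hms, measure_congr e, Real.volume_Ico]
  congr 1
  ring

theorem comp_cut_eq_sum (g : ℕ → ℝ) (n : ℕ) (u : ℝ) :
    g (cut n u) = ∑ i ∈ Finset.range (n + 1), {u | cut n u = i}.indicator (fun _ => g i) u := by
  rw [Finset.sum_eq_single_of_mem (cut n u) (Finset.mem_range_succ_iff.2 (cut_le n u))]
  · simp
  · intro i _ hi
    exact Set.indicator_of_notMem (fun h => hi h.symm) _

theorem integrable_comp_cut (g : ℕ → ℝ) (n : ℕ) : Integrable (fun u => g (cut n u)) unif := by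
  simp only [fun u => comp_cut_eq_sum g n u]
  exact integrable_finsetSum _ fun i _ =>
    (integrable_const _).indicator (measurableSet_cut_eq n i)

theorem integral_comp_cut (g : ℕ → ℝ) (n : ℕ) :
    ∫ u, g (cut n u) ∂unif = (∑ i ∈ Finset.range (n + 1), g i) / (n + 1) := by
  simp only [fun u => comp_cut_eq_sum g n u]
  rw [integral_finsetSum _ fun i _ =>
    (integrable_const _).indicator (measurableSet_cut_eq n i),
    Finset.sum_div]
  refine Finset.sum_congr rfl fun i hi => ?_
  rw [integral_indicator_const _ (measurableSet_cut_eq n i), measureReal_def,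
    unif_cut_eq (Finset.mem_range_succ_iff.1 hi), ENNReal.toReal_ofReal (by positivity),
    smul_eq_mul]
  ring

theorem integral_comp_sub_cut (g : ℕ → ℝ) (n : ℕ) :
    ∫ u, g (n - cut n u) ∂unif = (∑ i ∈ Finset.range (n + 1), g i) / (n + 1) := by
  rw [integral_comp_cut (fun i => g (n - i)) n]
  congr 1
  simpa using Finset.sum_range_reflect g (n + 1)

/-! ### Harmonic numbers and logarithms -/

theorem harm_mono : Monotone harm := by
  refine monotone_nat_of_le_succ fun n => ?_
  simp only [harm, harmonic_succ]
  push_cast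
  exact le_add_of_nonneg_right (by positivity)

/-- Taken at `n + 1`, this says that the average of `harm i - harm (n + 1)` over `i ≤ n` is `-1`,
the discrete counterpart of `E log ξ = -1`. -/
theorem sum_harm (n : ℕ) : ∑ i ∈ Finset.range n, harm i = n * harm n - n := by
  induction n with
  | zero => simp
  | succ n ih =>
    rw [Finset.sum_range_succ, ih]
    simp only [harm, harmonic_succ]
    push_cast
    field_simp
    ring

/-- From `log N + log v ≤ log (m + 1) ≤ H_m` and `H_N ≤ 1 + log N` the difference is at least `-1`;
from `H_m ≤ H_N` it is at most `-log v`. The bound does not depend on `N` or `m`, as dominated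
convergence requires. -/
theorem abs_harm_sub_sub_log_le {N m : ℕ} {v : ℝ} (hN : 0 < N) (hm : m ≤ N) (h0 : 0 < v)
    (h1 : v ≤ 1) (h : N * v ≤ m + 1) : |harm m - harm N - Real.log v| ≤ 1 - Real.log v := by
  have hN' : (0 : ℝ) < N := by exact_mod_cast hN
  have hl := Real.log_nonpos h0.le h1
  have a1 : Real.log N + Real.log v ≤ harm m := by
    rw [← Real.log_mul hN'.ne' h0.ne']
    refine (Real.log_le_log (by positivity) h).trans ?_
    exact_mod_cast log_add_one_le_harmonic m
  have a2 : harm N ≤ 1 + Real.log N := harmonic_le_one_add_log N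
  have a3 := harm_mono hm
  rw [abs_le]
  constructor <;> linarith

/-- Since `v > 0`, the sizes `m n` tend to infinity. Both harmonic numbers are then logarithms plus
Euler's constant up to `o(1)`, and the constant cancels. -/
theorem tendsto_harm_sub_sub_log {m : ℕ → ℕ} {v : ℝ} (h0 : 0 < v)
    (h : Tendsto (fun n : ℕ => (m n : ℝ) / ((n : ℝ) + 1)) atTop (𝓝 v)) :
    Tendsto (fun n => harm (m n) - harm (n + 1) - Real.log v) atTop (𝓝 0) := by
  have hn : Tendsto (fun n : ℕ => (n : ℝ) + 1) atTop atTop :=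
    tendsto_atTop_add_const_right _ _ tendsto_natCast_atTop_atTop
  have hmr : Tendsto (fun n => (m n : ℝ)) atTop atTop := by
    have := h.pos_mul_atTop h0 hn
    refine this.congr fun n => ?_
    field_simp
  have hm : Tendsto m atTop atTop := tendsto_natCast_atTop_iff.1 hmr
  have t1 := Real.tendsto_harmonic_sub_log.comp hm
  have t2 := Real.tendsto_harmonic_sub_log.comp (tendsto_add_atTop_nat 1)
  have t3 := (h.log h0.ne').sub_const (Real.log v)
  have t4 := (t1.sub t2).add t3
  simp only [sub_self, add_zero] at t4
  refine t4.congr' ?_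
  filter_upwards [hmr.eventually_gt_atTop 0] with n hpos
  simp only [Function.comp_apply, harm]
  rw [Real.log_div hpos.ne' (by positivity)]
  push_cast
  ring

theorem tendsto_cut_div {u : ℝ} (h0 : 0 ≤ u) (h1 : u < 1) :
    Tendsto (fun n : ℕ => (cut n u : ℝ) / ((n : ℝ) + 1)) atTop (𝓝 u) := by
  have hn : Tendsto (fun n : ℕ => (n : ℝ) + 1) atTop atTop :=
    tendsto_atTop_add_const_right _ _ tendsto_natCast_atTop_atTop
  refine ((tendsto_nat_floor_mul_div_atTop h0).comp hn).congr fun n => ?_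
  rw [cut_eq_floor h1, Function.comp_apply, mul_comm u]

theorem tendsto_sub_cut_div {u : ℝ} (h0 : 0 ≤ u) (h1 : u < 1) :
    Tendsto (fun n : ℕ => ((n - cut n u : ℕ) : ℝ) / ((n : ℝ) + 1)) atTop (𝓝 (1 - u)) := by
  have h := (tendsto_natCast_div_add_atTop (1 : ℝ)).sub (tendsto_cut_div h0 h1)
  refine h.congr fun n => ?_
  rw [Nat.cast_sub (cut_le n u)]
  ring

theorem tendsto_integral_log_error {m : ℕ → ℝ → ℕ} (hmeas : ∀ n, Measurable (m n)) {v : ℝ → ℝ}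
    (hv : MemLp (fun u => Real.log (v u)) 2 unif)
    (hv0 : ∀ᵐ u ∂unif, 0 < v u ∧ v u ≤ 1)
    (hle : ∀ n u, m n u ≤ n) (hge : ∀ n : ℕ, ∀ᵐ u ∂unif, ((n : ℝ) + 1) * v u ≤ m n u + 1)
    (hlim : ∀ᵐ u ∂unif, Tendsto (fun n : ℕ => (m n u : ℝ) / ((n : ℝ) + 1)) atTop (𝓝 (v u))) :
    (∀ n, MemLp (fun u => harm (m n u) - harm (n + 1) - Real.log (v u)) 2 unif) ∧
    Tendsto (fun n => ∫ u, (harm (m n u) - harm (n + 1) - Real.log (v u)) ^ 2 ∂unif) atTop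
      (𝓝 0) := by
  have hm (n : ℕ) : AEStronglyMeasurable
      (fun u => harm (m n u) - harm (n + 1) - Real.log (v u)) unif :=
    (((measurable_from_top (f := harm)).comp (hmeas n)).sub_const _).aestronglyMeasurable.sub hv.1
  have hb : MemLp (fun u => 1 - Real.log (v u)) 2 unif := (memLp_const 1).sub hv
  have hbd (n : ℕ) : ∀ᵐ u ∂unif,
      |harm (m n u) - harm (n + 1) - Real.log (v u)| ≤ 1 - Real.log (v u) := by
    filter_upwards [hv0, hge n] with u hu hg
    exact abs_harm_sub_sub_log_le (Nat.succ_pos n) ((hle n u).trans (Nat.le_succ n)) hu.1 hu.2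
      (by push_cast; exact hg)
  refine ⟨fun n => hb.mono (hm n) ?_, ?_⟩
  · filter_upwards [hbd n] with u hu
    exact hu.trans (le_abs_self _)
  · have h := tendsto_integral_of_dominated_convergence
      (fun u => (1 - Real.log (v u)) ^ 2) (fun n => (hm n).pow 2) hb.integrable_sq
      (fun n => ?_) (f := fun _ => (0 : ℝ)) ?_
    · simpa using h
    · filter_upwards [hbd n] with u hu
      simp only [Pi.pow_apply]
      rw [Real.norm_of_nonneg (sq_nonneg _)]
      exact sq_le_sq.2 (hu.trans (le_abs_self _))
    · filter_upwards [hlim, hv0] with u hu hu0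
      simpa using (tendsto_harm_sub_sub_log hu0.1 hu).pow 2

theorem ae_unif_mem_Ioo : ∀ᵐ u ∂unif, u ∈ Set.Ioo (0 : ℝ) 1 := by
  rw [unif, ← restrict_Ioo_eq_restrict_Icc]
  exact ae_restrict_mem measurableSet_Ioo

/-- The discretization error of the logarithmic term of the left subtree. -/
def errL (n : ℕ) (u : ℝ) : ℝ := harm (cut n u) - harm (n + 1) - Real.log u

/-- The discretization error of the logarithmic term of the right subtree. -/
def errR (n : ℕ) (u : ℝ) : ℝ := harm (n - cut n u) - harm (n + 1) - Real.log (1 - u)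

theorem errL_props : (∀ n, MemLp (errL n) 2 unif) ∧
    Tendsto (fun n => ∫ u, errL n u ^ 2 ∂unif) atTop (𝓝 0) := by
  refine tendsto_integral_log_error (v := fun u => u) measurable_cut memLp_log ?_ cut_le
    (fun n => ?_) ?_
  · filter_upwards [ae_unif_mem_Ioo] with u hu using ⟨hu.1, hu.2.le⟩
  · filter_upwards [ae_unif_mem_Ioo] with u hu
    rw [cut_eq_floor hu.2]
    exact (Nat.lt_floor_add_one _).le
  · filter_upwards [ae_unif_mem_Ioo] with u hu using tendsto_cut_div hu.1.le hu.2

theorem errR_props : (∀ n, MemLp (errR n) 2 unif) ∧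
    Tendsto (fun n => ∫ u, errR n u ^ 2 ∂unif) atTop (𝓝 0) := by
  refine tendsto_integral_log_error (v := fun u => 1 - u) (m := fun n u => n - cut n u)
    (fun n => measurable_const.sub (measurable_cut n)) memLp_log_one_sub ?_
    (fun n u => Nat.sub_le _ _) (fun n => ?_) ?_
  · filter_upwards [ae_unif_mem_Ioo] with u hu using ⟨sub_pos.2 hu.2, by linarith [hu.1]⟩
  · filter_upwards [ae_unif_mem_Ioo] with u hu
    rw [Nat.cast_sub (cut_le n u), cut_eq_floor hu.2]
    have := Nat.floor_le (a := ((n : ℝ) + 1) * u) (mul_nonneg (by positivity) hu.1.le)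
    linarith
  · filter_upwards [ae_unif_mem_Ioo] with u hu using tendsto_sub_cut_div hu.1.le hu.2

/-! ### A Cesàro contraction -/

/-- Once `x` is known to be bounded, the Cesàro means have limsup at most that of `x`, so `L =
limsup x` satisfies `L ≤ c L`, which forces `L ≤ 0`. -/
theorem tendsto_zero_of_le_mean {x e : ℕ → ℝ} {c : ℝ} (hx : ∀ n, 0 ≤ x n) (hc0 : 0 ≤ c)
    (hc : c < 1) (he : Tendsto e atTop (𝓝 0))
    (h : ∀ n, x (n + 1) ≤ c * ((∑ i ∈ Finset.range (n + 1), x i) / (n + 1)) + e n) :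
    Tendsto x atTop (𝓝 0) := by
  obtain ⟨B, hB⟩ := he.bddAbove_range
  have hB' (n : ℕ) : e n ≤ B := hB ⟨n, rfl⟩
  -- `K` is chosen so that `c K + B ≤ K`, which closes the strong induction for the bound.
  set K := max (x 0) (B / (1 - c)) with hK
  have hK0 : 0 ≤ K := (hx 0).trans (le_max_left _ _)
  have hBK : B ≤ (1 - c) * K := by
    rw [mul_comm, ← div_le_iff₀ (by linarith)]
    exact le_max_right _ _
  have mean_le {n : ℕ} {y : ℕ → ℝ} {C : ℝ} (hy : ∀ i ≤ n, y i ≤ C) :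
      (∑ i ∈ Finset.range (n + 1), y i) / ((n : ℝ) + 1) ≤ C := by
    rw [div_le_iff₀ (by positivity)]
    refine (Finset.sum_le_card_nsmul _ _ C fun i hi =>
      hy i (Finset.mem_range_succ_iff.1 hi)).trans_eq ?_
    simp [mul_comm]
  have hbd (n : ℕ) : x n ≤ K := by
    induction n using Nat.strong_induction_on with
    | _ n ih =>
      rcases n with _ | n
      · exact le_max_left _ _
      · have := mean_le (n := n) fun i hi => ih i (by omega)
        have := h n
        have := hB' n
        nlinarith
  have hbdd : IsBoundedUnder (· ≤ ·) atTop x := isBoundedUnder_of ⟨K, hbd⟩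
  have hcob : IsCoboundedUnder (· ≤ ·) atTop x :=
    (isBoundedUnder_of ⟨0, hx⟩ : IsBoundedUnder (· ≥ ·) atTop x).isCoboundedUnder_le
  set L := limsup x atTop with hL
  have hstep (ε : ℝ) (hε : 0 < ε) : L ≤ c * (L + ε) + ε := by
    have hev : ∀ᶠ n in atTop, x n ≤ L + ε :=
      (eventually_lt_of_limsup_lt (by linarith : limsup x atTop < L + ε) hbdd).mono fun _ => le_of_lt
    obtain ⟨N, hN⟩ := eventually_atTop.1 hev
    -- The first `N` terms are bounded only by `K`, but their share in the mean is of order `1 / (n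
    -- + 1)`.
    have hsum (n : ℕ) : (∑ i ∈ Finset.range (n + 1), x i) / ((n : ℝ) + 1) ≤
        (L + ε) + (N * K) / ((n : ℝ) + 1) := by
      have hLe : 0 ≤ L + ε := (hx N).trans (hN N le_rfl)
      have h1 : ∑ i ∈ Finset.range (n + 1), x i ≤
          ∑ i ∈ Finset.range (n + 1), ((L + ε) + if i < N then K else 0) := by
        refine Finset.sum_le_sum fun i _ => ?_
        split_ifs with hi
        · linarith [hbd i]
        · linarith [hN i (not_lt.1 hi)]
      have h2 : ∑ i ∈ Finset.range (n + 1), (if i < N then K else 0) ≤ N * K := by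
        rw [← Finset.sum_filter, Finset.sum_const, nsmul_eq_mul]
        refine mul_le_mul_of_nonneg_right ?_ hK0
        have : (Finset.range (n + 1)).filter (· < N) ⊆ Finset.range N := fun i hi => by
          simp only [Finset.mem_filter] at hi
          exact Finset.mem_range.2 hi.2
        exact_mod_cast (Finset.card_le_card this).trans_eq (Finset.card_range N)
      rw [Finset.sum_add_distrib, Finset.sum_const, Finset.card_range, nsmul_eq_mul] at h1
      rw [div_le_iff₀ (by positivity), add_mul, div_mul_cancel₀ _ (by positivity)]
      push_cast at h1
      linarith
    have hlim : Tendsto (fun n : ℕ => c * ((L + ε) + (N * K) / ((n : ℝ) + 1)) + e n) atTop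
        (𝓝 (c * ((L + ε) + 0) + 0)) := by
      have hz : Tendsto (fun n : ℕ => (N * K) / ((n : ℝ) + 1)) atTop (𝓝 0) :=
        tendsto_const_nhds.div_atTop
          (tendsto_atTop_add_const_right _ _ tendsto_natCast_atTop_atTop)
      exact ((tendsto_const_nhds.add hz).const_mul c).add he
    have hev2 : ∀ᶠ n in atTop, x (n + 1) ≤ c * (L + ε) + ε := by
      have : ∀ᶠ n : ℕ in atTop, c * ((L + ε) + (N * K) / ((n : ℝ) + 1)) + e n <
          c * (L + ε) + ε := hlim.eventually_lt_const (by simp; linarith)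
      filter_upwards [this] with n hn
      have := mul_le_mul_of_nonneg_left (hsum n) hc0
      linarith [h n]
    have hev3 : ∀ᶠ n in atTop, x n ≤ c * (L + ε) + ε := by
      rw [eventually_atTop] at hev2 ⊢
      obtain ⟨N', hN'⟩ := hev2
      refine ⟨N' + 1, fun n hn => ?_⟩
      obtain ⟨k, rfl⟩ : ∃ k, n = k + 1 := ⟨n - 1, by omega⟩
      exact hN' k (by omega)
    exact limsup_le_of_le hcob hev3
  have hL0 : L ≤ 0 := by
    have h1 : L ≤ c * L := by
      refine le_of_forall_pos_le_add fun ε hε => ?_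
      have := hstep (ε / 2) (by positivity)
      nlinarith
    nlinarith
  have hge : 0 ≤ liminf x atTop := le_liminf_of_le
    (isBoundedUnder_of ⟨K, hbd⟩ : IsBoundedUnder (· ≤ ·) atTop x).isCoboundedUnder_ge
    (Eventually.of_forall hx)
  exact tendsto_of_le_liminf_of_limsup_le hge hL0 hbdd (isBoundedUnder_of ⟨0, hx⟩)

/-! ### Random trees on the space of labels -/

instance : MeasurableSpace (BinaryTree Unit) := ⊤

instance : Countable (BinaryTree Unit) := by
  have h : (Set.univ : Set (BinaryTree Unit)) =
      ⋃ n, (BinaryTree.treesOfNumNodesEq n : Set (BinaryTree Unit)) := by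
    ext t; simp
  rw [← Set.countable_univ_iff, h]
  exact Set.countable_iUnion fun n => (Finset.finite_toSet _).countable

/-- A random tree with `n` nodes: the sizes of the subtrees are obtained from the labels. -/
def randomTree : ℕ → Labels → BinaryTree Unit
  | 0, _ => .nil
  | n + 1, ω => .node () (randomTree (cut n (ω [])) (subLabels false ω))
      (randomTree (n - cut n (ω [])) (subLabels true ω))
termination_by n => n
decreasing_by
  · exact Nat.lt_succ_of_le (cut_le _ _)
  · exact Nat.lt_succ_of_le (Nat.sub_le _ _)

theorem randomTree_zero (ω : Labels) : randomTree 0 ω = .nil := by rw [randomTree]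

theorem randomTree_succ (n : ℕ) (ω : Labels) :
    randomTree (n + 1) ω = .node () (randomTree (cut n (ω [])) (subLabels false ω))
      (randomTree (n - cut n (ω [])) (subLabels true ω)) := by
  rw [randomTree]

theorem numNodes_randomTree (n : ℕ) (ω : Labels) : (randomTree n ω).numNodes = n := by
  induction n using Nat.strong_induction_on generalizing ω with
  | _ n ih =>
    rcases n with _ | n
    · rw [randomTree_zero]; rfl
    · have := cut_le n (ω [])
      rw [randomTree_succ, BinaryTree.numNodes, ih _ (by omega), ih _ (by omega)]
      omega

theorem randomTree_succ_eq_node_iff (n : ℕ) (ω : Labels) (l r : BinaryTree Unit)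
    (h : l.numNodes + r.numNodes = n) :
    randomTree (n + 1) ω = .node () l r ↔ cut n (ω []) = l.numNodes ∧
      randomTree l.numNodes (subLabels false ω) = l ∧
      randomTree r.numNodes (subLabels true ω) = r := by
  rw [randomTree_succ]
  simp only [BinaryTree.node.injEq, true_and]
  constructor
  · rintro ⟨hl, hr⟩
    have h1 : cut n (ω []) = l.numNodes := by rw [← hl, numNodes_randomTree]
    have h2 : n - cut n (ω []) = r.numNodes := by omega
    rw [h2] at hr
    rw [h1] at hl
    exact ⟨h1, hl, hr⟩
  · rintro ⟨h1, hl, hr⟩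
    have h2 : n - cut n (ω []) = r.numNodes := by omega
    rw [h2, h1]
    exact ⟨hl, hr⟩

theorem measurableSet_randomTree_eq (t : BinaryTree Unit) (n : ℕ) :
    MeasurableSet {ω | randomTree n ω = t} := by
  by_cases hn : t.numNodes = n
  swap
  · convert MeasurableSet.empty (α := Labels)
    ext ω
    simp only [Set.mem_ofPred_eq, Set.mem_empty_iff_false, iff_false]
    rintro rfl
    exact hn (numNodes_randomTree n ω)
  induction t generalizing n with
  | nil =>
    obtain rfl : n = 0 := hn.symm
    simp [randomTree_zero]
  | node a l r ihl ihr =>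
    obtain rfl : n = l.numNodes + r.numNodes + 1 := hn.symm
    have e : {ω | randomTree (l.numNodes + r.numNodes + 1) ω = .node a l r} =
        ((fun ω : Labels => ω []) ⁻¹' {u | cut (l.numNodes + r.numNodes) u = l.numNodes}) ∩
          (subLabels false ⁻¹' {ω | randomTree l.numNodes ω = l} ∩
            subLabels true ⁻¹' {ω | randomTree r.numNodes ω = r}) := by
      ext ω
      exact randomTree_succ_eq_node_iff _ ω l r rfl
    rw [e]
    exact (measurable_pi_apply [] (measurableSet_cut_eq _ _)).inter
      ((measurable_subLabels _ (ihl _ rfl)).inter (measurable_subLabels _ (ihr _ rfl)))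

theorem measurable_randomTree (n : ℕ) : Measurable (randomTree n) :=
  measurable_to_countable' fun t => measurableSet_randomTree_eq t n

/-! ### Tree functionals that follow the recursion, and their centering -/

namespace AffineRec

section Convergence

variable {E : Type*} [NormedAddCommGroup E] [NormedSpace ℝ E] (R : AffineRec E)
  [MeasurableSpace E] [BorelSpace E] [SecondCountableTopology E]

/-- `F` is a tree functional that satisfies the recursion `R` with harmonic numbers instead of
logarithms. -/
structure IsFunctional (F : BinaryTree Unit → E × ℝ) : Prop where
  nil : F .nil = 0
  node : ∀ l r, F (.node () l r) = R.combine (F l) (F r)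
    (harm l.numNodes - harm (l.numNodes + r.numNodes + 1))
    (harm r.numNodes - harm (l.numNodes + r.numNodes + 1))

variable {R} {F : BinaryTree Unit → E × ℝ}

theorem measurable_functional (F : BinaryTree Unit → E × ℝ) (n : ℕ) :
    Measurable fun ω => F (randomTree n ω) :=
  measurable_from_top.comp (measurable_randomTree n)

theorem memLp_functional (F : BinaryTree Unit → E × ℝ) (n : ℕ) :
    MemLp (fun ω => F (randomTree n ω)) 2 labelLaw := by
  refine MemLp.of_bound (measurable_functional F n).aestronglyMeasurable
    (∑ t ∈ BinaryTree.treesOfNumNodesEq n, ‖F t‖) (ae_of_all _ fun ω => ?_)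
  exact Finset.single_le_sum (f := fun t => ‖F t‖) (fun _ _ => norm_nonneg _)
    (BinaryTree.mem_treesOfNumNodesEq.2 (numNodes_randomTree n ω))

theorem IsFunctional.apply_succ (hF : R.IsFunctional F) (n : ℕ) (ω : Labels) :
    F (randomTree (n + 1) ω) =
      R.combine (F (randomTree (cut n (ω [])) (subLabels false ω)))
        (F (randomTree (n - cut n (ω [])) (subLabels true ω)))
        (harm (cut n (ω [])) - harm (n + 1)) (harm (n - cut n (ω [])) - harm (n + 1)) := by
  rw [randomTree_succ, hF.node, numNodes_randomTree, numNodes_randomTree,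
    Nat.add_sub_of_le (cut_le _ _)]

/-- Fubini's theorem for the decomposition of the labels at the root. -/
theorem integral_labelLaw_eq {G : Labels → ℝ} (hG : Integrable G labelLaw)
    {Γ : ℝ × Labels × Labels → ℝ} (hΓ : Measurable Γ)
    (h : ∀ᵐ ω ∂labelLaw, G ω = Γ (splitLabels ω)) :
    Integrable (fun u => ∫ p, Γ (u, p) ∂(labelLaw.prod labelLaw)) unif ∧
    ∫ ω, G ω ∂labelLaw = ∫ u, ∫ p, Γ (u, p) ∂(labelLaw.prod labelLaw) ∂unif := by
  have hmp := measurePreserving_splitLabels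
  have hi : Integrable Γ (unif.prod (labelLaw.prod labelLaw)) :=
    (hmp.integrable_comp hΓ.aestronglyMeasurable).1 (hG.congr h)
  refine ⟨hi.integral_prod_left, ?_⟩
  rw [integral_congr_ae h, ← integral_prod _ hi, ← hmp.map_eq,
    integral_map hmp.measurable.aemeasurable hΓ.aestronglyMeasurable]

/-- Needed because the subtree sizes are themselves random; measurability survives as the index
ranges over a countable set. -/
theorem measurable_index {X Y : Type*} [MeasurableSpace X] [MeasurableSpace Y]
    {D : ℕ → Labels → X} (hD : ∀ n, Measurable (D n)) {i : Y → ℕ} (hi : Measurable i)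
    {g : Y → Labels} (hg : Measurable g) : Measurable fun y => D (i y) (g y) :=
  (measurable_from_prod_countable_right (f := fun q : ℕ × Labels => D q.1 q.2) hD).comp
    (hi.prodMk hg)

/-- Induction on the size: given the root label, both subtree terms have mean zero, and the
remaining deterministic term averages to `1 + (-1 - 1)/2 = 0` over the uniform split. -/
theorem integral_functional_snd (hF : R.IsFunctional F) (n : ℕ) :
    ∫ ω, (F (randomTree n ω)).2 ∂labelLaw = 0 := by
  induction n using Nat.strong_induction_on with
  | _ n ih =>
    rcases n with _ | n
    · simp [randomTree_zero, hF.nil]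
    have mD (n : ℕ) : Measurable fun ω => (F (randomTree n ω)).2 :=
      measurable_snd.comp (measurable_functional F n)
    have iD (n : ℕ) : Integrable (fun ω => (F (randomTree n ω)).2) labelLaw :=
      (memLp_snd (memLp_functional F n)).integrable (by norm_num)
    let c (u : ℝ) : ℝ := 1 + 1 / 2 * ((harm (cut n u) - harm (n + 1)) +
      (harm (n - cut n u) - harm (n + 1)))
    let Γ (q : ℝ × Labels × Labels) : ℝ := 1 / 2 * (F (randomTree (cut n q.1) q.2.1)).2 +
      1 / 2 * (F (randomTree (n - cut n q.1) q.2.2)).2 + c q.1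
    have mc : Measurable c :=
      ((((measurable_from_top (f := harm)).comp (measurable_cut n)).sub_const _).add
        (((measurable_from_top (f := harm)).comp
          (measurable_const.sub (measurable_cut n))).sub_const _)).const_mul _ |>.const_add 1
    have m1 : Measurable fun q : ℝ × Labels × Labels => (F (randomTree (cut n q.1) q.2.1)).2 :=
      measurable_index mD ((measurable_cut n).comp measurable_fst) (by fun_prop)
    have m2 : Measurable fun q : ℝ × Labels × Labels =>
        (F (randomTree (n - cut n q.1) q.2.2)).2 :=
      measurable_index mD (measurable_const.sub ((measurable_cut n).comp measurable_fst))
        (by fun_prop)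
    have hΓ : Measurable Γ :=
      ((m1.const_mul _).add (m2.const_mul _)).add (mc.comp measurable_fst)
    rw [(integral_labelLaw_eq (iD (n + 1)) hΓ (ae_of_all _ fun ω => ?_)).2]
    swap
    · simp only [hF.apply_succ, combine, Γ, c, splitLabels]
      ring
    have hin (u : ℝ) : ∫ p : Labels × Labels, Γ (u, p) ∂(labelLaw.prod labelLaw) = c u := by
      have i1 : Integrable (fun p : Labels × Labels => 1 / 2 * (F (randomTree (cut n u) p.1)).2)
          (labelLaw.prod labelLaw) := ((iD _).comp_fst _).const_mul _
      have i2 : Integrable (fun p : Labels × Labels =>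
          1 / 2 * (F (randomTree (n - cut n u) p.2)).2)
          (labelLaw.prod labelLaw) := ((iD _).comp_snd _).const_mul _
      have z1 : ∫ p : Labels × Labels, 1 / 2 * (F (randomTree (cut n u) p.1)).2
          ∂(labelLaw.prod labelLaw) = 0 := by
        rw [integral_const_mul, integral_fun_fst (f := fun ω => (F (randomTree (cut n u) ω)).2),
          ih _ (Nat.lt_succ_of_le (cut_le _ _))]
        simp
      have z2 : ∫ p : Labels × Labels, 1 / 2 * (F (randomTree (n - cut n u) p.2)).2
          ∂(labelLaw.prod labelLaw) = 0 := by
        rw [integral_const_mul,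
          integral_fun_snd (f := fun ω => (F (randomTree (n - cut n u) ω)).2),
          ih _ (Nat.lt_succ_of_le (Nat.sub_le _ _))]
        simp
      refine (integral_add (i1.add i2) (integrable_const (c u))).trans ?_
      have := integral_add i1 i2
      rw [z1, z2] at this
      simp only [Pi.add_apply]
      rw [this]
      simp
    simp only [hin]
    have j1 := integrable_comp_cut (fun i => harm i - harm (n + 1)) n
    have j2 := integrable_comp_cut (fun i => harm (n - i) - harm (n + 1)) n
    have k1 := integral_comp_cut (fun i => harm i - harm (n + 1)) n
    have k2 := integral_comp_sub_cut (fun i => harm i - harm (n + 1)) n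
    have hs : (∑ i ∈ Finset.range (n + 1), (harm i - harm (n + 1))) / ((n : ℝ) + 1) = -1 := by
      rw [Finset.sum_sub_distrib, sum_harm, Finset.sum_const, Finset.card_range, nsmul_eq_mul]
      push_cast
      field_simp
      ring
    rw [hs] at k1 k2
    refine (integral_add (integrable_const 1) ((j1.add j2).const_mul (1 / 2))).trans ?_
    rw [integral_const_mul]
    have := integral_add j1 j2
    rw [k1, k2] at this
    simp only [Pi.add_apply]
    rw [this]
    simp
    norm_num

theorem centered_functional (hF : R.IsFunctional F) (n : ℕ) :
    Centered fun ω => F (randomTree n ω) :=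
  ⟨measurable_functional F n, memLp_functional F n, integral_functional_snd hF n⟩

end Convergence

end AffineRec

/-! ### Convergence of functionals of the random tree -/

theorem measurable_errL (n : ℕ) : Measurable (errL n) :=
  (((measurable_from_top (f := harm)).comp (measurable_cut n)).sub_const _).sub
    Real.measurable_log

theorem measurable_errR (n : ℕ) : Measurable (errR n) :=
  (((measurable_from_top (f := harm)).comp (measurable_const.sub (measurable_cut n))).sub_const
    _).sub (Real.measurable_log.comp (measurable_const.sub measurable_id))

/-- The total squared discretization error. -/
def err (n : ℕ) : ℝ := ∫ u, errL n u ^ 2 ∂unif + ∫ u, errR n u ^ 2 ∂unif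

theorem tendsto_err : Tendsto err atTop (𝓝 0) := by
  have h := errL_props.2.add errR_props.2
  rw [add_zero] at h
  exact h

namespace AffineRec

section Convergence

variable {E : Type*} [NormedAddCommGroup E] [NormedSpace ℝ E] {R : AffineRec E}
  [MeasurableSpace E] [BorelSpace E] [SecondCountableTopology E]
  {F : BinaryTree Unit → E × ℝ} {Z : Labels → E × ℝ}

/-- The difference between a functional of the random tree and a fixed point. -/
def gap (F : BinaryTree Unit → E × ℝ) (Z : Labels → E × ℝ) (n : ℕ) (ω : Labels) : E × ℝ :=
  F (randomTree n ω) - Z ω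

/-- `AffineRec.gap` at size `n + 1`, in terms of the decomposition of the labels at the root. -/
def gapSplit (R : AffineRec E) (F : BinaryTree Unit → E × ℝ) (Z : Labels → E × ℝ) (n : ℕ)
    (q : ℝ × Labels × Labels) : E × ℝ :=
  R.combineLin (gap F Z (cut n q.1) q.2.1) (gap F Z (n - cut n q.1) q.2.2)
    (errL n q.1) (errR n q.1)

theorem measurable_gap (hZ : Centered Z) (n : ℕ) : Measurable (gap F Z n) :=
  (measurable_functional F n).sub hZ.measurable

theorem memLp_gap (hZ : Centered Z) (n : ℕ) : MemLp (gap F Z n) 2 labelLaw :=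
  (memLp_functional F n).sub hZ.memLp

theorem integral_gap_snd (hF : R.IsFunctional F) (hZ : Centered Z) (n : ℕ) :
    ∫ ω, (gap F Z n ω).2 ∂labelLaw = 0 :=
  (centered_functional hF n).integral_sub_snd hZ

theorem measurable_gapSplit (hZ : Centered Z) (n : ℕ) : Measurable (R.gapSplit F Z n) := by
  have hc : Measurable fun q : ℝ × Labels × Labels => cut n q.1 :=
    (measurable_cut n).comp measurable_fst
  have m1 : Measurable fun q : ℝ × Labels × Labels => gap F Z (cut n q.1) q.2.1 :=
    measurable_index (measurable_gap hZ) hc measurable_snd.fst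
  have m2 : Measurable fun q : ℝ × Labels × Labels => gap F Z (n - cut n q.1) q.2.2 :=
    measurable_index (measurable_gap hZ) (measurable_const.sub hc) measurable_snd.snd
  have m3 : Measurable fun q : ℝ × Labels × Labels => errL n q.1 :=
    (measurable_errL n).comp measurable_fst
  have m4 : Measurable fun q : ℝ × Labels × Labels => errR n q.1 :=
    (measurable_errR n).comp measurable_fst
  have h := R.continuous_combineLin.measurable.comp (m1.prodMk (m2.prodMk (m3.prodMk m4)))
  exact h

/-- Both sides split along the same root label, so only the mismatch between harmonic differences
and logarithms survives besides the gaps of the subtrees. The identity is almost sure because `Z` is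
only almost surely fixed. -/
theorem gap_succ (hF : R.IsFunctional F) (hZ : ∀ᵐ ω ∂labelLaw, R.lift Z ω = Z ω) (n : ℕ) :
    ∀ᵐ ω ∂labelLaw, gap F Z (n + 1) ω = R.gapSplit F Z n (splitLabels ω) := by
  filter_upwards [hZ] with ω h
  rw [gap, hF.apply_succ, ← h, lift, step, combine_sub_combine]
  rfl

/-- The mean of the first `n + 1` terms of a sequence. -/
def mean (x : ℕ → ℝ) (n : ℕ) : ℝ := (∑ i ∈ Finset.range (n + 1), x i) / (n + 1)

theorem integral_mean_add_err (x : ℕ → ℝ) (n : ℕ) {e : ℝ → ℝ} (he : Integrable e unif) :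
    Integrable (fun u => x (cut n u) + x (n - cut n u) + e u) unif ∧
    ∫ u, (x (cut n u) + x (n - cut n u) + e u) ∂unif = 2 * mean x n + ∫ u, e u ∂unif := by
  have j1 := integrable_comp_cut x n
  have j2 := integrable_comp_cut (fun i => x (n - i)) n
  refine ⟨(j1.add j2).add he, ?_⟩
  refine (integral_add (j1.add j2) he).trans ?_
  have := integral_add j1 j2
  rw [integral_comp_cut, integral_comp_sub_cut] at this
  simp only [Pi.add_apply]
  rw [this, mean]
  ring

theorem integral_sq_add_le {f g : ℝ → ℝ} (hf : MemLp f 2 unif) (hg : MemLp g 2 unif) :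
    ∫ u, (f u + g u) ^ 2 ∂unif ≤ 2 * (∫ u, f u ^ 2 ∂unif + ∫ u, g u ^ 2 ∂unif) := by
  rw [← integral_add hf.integrable_sq hg.integrable_sq, ← integral_const_mul]
  refine integral_mono (hf.add hg).integrable_sq
    ((hf.integrable_sq.add hg.integrable_sq).const_mul 2) fun u => ?_
  simp only
  nlinarith [sq_nonneg (f u - g u)]

/-- Given the root label, the gaps of the subtrees are independent and centered, so their second
moments add with factor 1/4. Both subtree sizes are uniform, so averaging over the label produces
twice the mean. -/
theorem gap_snd_sq_succ_le (hF : R.IsFunctional F) (hZ : Centered Z)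
    (hfix : ∀ᵐ ω ∂labelLaw, R.lift Z ω = Z ω) (n : ℕ) :
    ∫ ω, (gap F Z (n + 1) ω).2 ^ 2 ∂labelLaw ≤
      1 / 2 * mean (fun i => ∫ ω, (gap F Z i ω).2 ^ 2 ∂labelLaw) n + 1 / 2 * err n := by
  have hm := measurable_gapSplit (R := R) (F := F) hZ n
  have hG := integral_labelLaw_eq (integrable_snd_sq (memLp_gap (F := F) hZ (n + 1)))
    ((measurable_snd.comp hm).pow_const 2)
    ((gap_succ hF hfix n).mono fun ω h => by rw [h]; rfl)
  rw [hG.2]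
  have hin (u : ℝ) := R.integral_combineLin_snd_sq (memLp_gap (F := F) hZ (cut n u))
    (memLp_gap (F := F) hZ (n - cut n u)) (integral_gap_snd hF hZ _) (integral_gap_snd hF hZ _)
    (errL n u) (errR n u)
  have he := errL_props.1 n
  have he' := errR_props.1 n
  have hI := integral_mean_add_err (fun i => ∫ ω, (gap F Z i ω).2 ^ 2 ∂labelLaw) n
    (he.add he').integrable_sq
  refine (integral_congr_ae (ae_of_all _ hin)).trans_le ?_
  rw [integral_const_mul]
  have h2 := integral_sq_add_le he he'
  have h3 := hI.2
  simp only [Pi.add_apply] at h3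
  rw [h3, err]
  linarith

theorem gap_fst_sq_succ_le (hF : R.IsFunctional F) (hZ : Centered Z)
    (hfix : ∀ᵐ ω ∂labelLaw, R.lift Z ω = Z ω) (n : ℕ) :
    ∫ ω, ‖(gap F Z (n + 1) ω).1‖ ^ 2 ∂labelLaw ≤
      3 / 4 * mean (fun i => ∫ ω, ‖(gap F Z i ω).1‖ ^ 2 ∂labelLaw) n +
      (3 / 8 * mean (fun i => ∫ ω, (gap F Z i ω).2 ^ 2 ∂labelLaw) n + 3 / 8 * err n) := by
  have hm := measurable_gapSplit (R := R) (F := F) hZ n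
  have hG := integral_labelLaw_eq (integrable_norm_fst_sq (memLp_gap (F := F) hZ (n + 1)))
    ((measurable_fst.comp hm).norm.pow_const 2)
    ((gap_succ hF hfix n).mono fun ω h => by rw [h]; rfl)
  rw [hG.2]
  have hin (u : ℝ) := R.integral_combineLin_fst_sq_le (memLp_gap (F := F) hZ (cut n u))
    (memLp_gap (F := F) hZ (n - cut n u)) (integral_gap_snd hF hZ _) (integral_gap_snd hF hZ _)
    (errL n u) (errR n u)
  have he := errL_props.1 n
  have he' := errR_props.1 n
  have hI := integral_mean_add_err (fun i => ∫ ω, (gap F Z i ω).2 ^ 2 ∂labelLaw) n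
    (he.sub he').integrable_sq
  have hJ := integral_mean_add_err (fun i => ∫ ω, ‖(gap F Z i ω).1‖ ^ 2 ∂labelLaw) n
    (e := fun _ => 0) (integrable_zero ℝ ℝ unif)
  simp only [add_zero, integral_zero] at hJ
  refine (integral_mono hG.1 ((hJ.1.const_mul (3 / 8)).add (hI.1.const_mul (3 / 16))) hin).trans ?_
  refine (integral_add (hJ.1.const_mul (3 / 8)) (hI.1.const_mul (3 / 16))).trans_le ?_
  rw [integral_const_mul, integral_const_mul, hJ.2, hI.2]
  have h2 := integral_sq_add_le he he'.neg
  simp only [Pi.neg_apply, neg_sq, ← sub_eq_add_neg] at h2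
  have h3 : ∫ u, (errL n - errR n) u ^ 2 ∂unif = ∫ u, (errL n u - errR n u) ^ 2 ∂unif := rfl
  rw [err]
  linarith

theorem tendsto_mean {x : ℕ → ℝ} (h : Tendsto x atTop (𝓝 0)) : Tendsto (mean x) atTop (𝓝 0) := by
  have := (h.cesaro).comp (tendsto_add_atTop_nat 1)
  refine this.congr fun n => ?_
  simp only [Function.comp_apply, mean]
  push_cast
  ring

/-- The estimate for the second component is closed in itself. Its limit 0 passes to Cesàro means,
which then enter the estimate for the first component as part of the null sequence. -/
theorem tendsto_gap (hF : R.IsFunctional F) (hZ : Centered Z)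
    (hfix : ∀ᵐ ω ∂labelLaw, R.lift Z ω = Z ω) :
    Tendsto (fun n => energy (gap F Z n)) atTop (𝓝 0) := by
  have hb : Tendsto (fun n => ∫ ω, (gap F Z n ω).2 ^ 2 ∂labelLaw) atTop (𝓝 0) :=
    tendsto_zero_of_le_mean (c := 1 / 2) (e := fun n => 1 / 2 * err n)
      (fun n => integral_nonneg fun _ => sq_nonneg _) (by norm_num) (by norm_num)
      (by simpa only [mul_zero] using tendsto_err.const_mul (1 / 2)) (gap_snd_sq_succ_le hF hZ hfix)
  have ha : Tendsto (fun n => ∫ ω, ‖(gap F Z n ω).1‖ ^ 2 ∂labelLaw) atTop (𝓝 0) :=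
    tendsto_zero_of_le_mean (c := 3 / 4)
      (fun n => integral_nonneg fun _ => sq_nonneg _) (by norm_num) (by norm_num)
      (by simpa only [mul_zero, add_zero] using
        ((tendsto_mean hb).const_mul (3 / 8)).add (tendsto_err.const_mul (3 / 8)))
      (gap_fst_sq_succ_le hF hZ hfix)
  have h := ha.add (hb.const_mul 2)
  rw [mul_zero, add_zero] at h
  exact h

theorem tendstoInDistribution_functional (hF : R.IsFunctional F) (hZ : Centered Z)
    (hfix : ∀ᵐ ω ∂labelLaw, R.lift Z ω = Z ω) :
    TendstoInDistribution (fun n ω => F (randomTree n ω)) atTop Z (fun _ => labelLaw)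
      labelLaw := by
  refine TendstoInMeasure.tendstoInDistribution ?_
    fun n => (measurable_functional F n).aemeasurable
  refine tendstoInMeasure_of_tendsto_eLpNorm (p := 2) two_ne_zero
    (fun n => (memLp_functional F n).1) hZ.memLp.1 ?_
  have h0 : Tendsto (fun n => ENNReal.ofReal (Real.sqrt (energy (gap F Z n)))) atTop (𝓝 0) := by
    have h1 := (Real.continuous_sqrt.tendsto 0).comp (tendsto_gap hF hZ hfix)
    rw [Real.sqrt_zero] at h1
    simpa using ENNReal.tendsto_ofReal h1
  refine tendsto_of_tendsto_of_tendsto_of_le_of_le tendsto_const_nhds h0 (fun n => zero_le)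
    fun n => ?_
  have hL := memLp_gap (F := F) hZ n
  have h2 := norm_toLp_sq_le_energy hL
  rw [Lp.norm_toLp] at h2
  change eLpNorm (gap F Z n) 2 labelLaw ≤ _
  rw [← ENNReal.ofReal_toReal hL.2.ne]
  exact ENNReal.ofReal_le_ofReal (Real.le_sqrt_of_sq_le h2)

end Convergence

end AffineRec

/-! ### Binary search trees of lists -/

/-- The shape of the binary search tree of a list of keys. -/
def bstShape (l : List ℝ) : BinaryTree Unit :=
  shape (l.foldl (fun t x => insertKey x t) .nil)

/-- Later keys go to one side of the root or the other and keep their relative order there, so the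
two subtrees grow independently of each other. -/
theorem foldl_insertKey_node (a : ℝ) (xs : List ℝ) (l r : BinaryTree ℝ) :
    xs.foldl (fun t x => insertKey x t) (.node a l r) =
      .node a ((xs.filter (· < a)).foldl (fun t x => insertKey x t) l)
        ((xs.filter (¬ · < a)).foldl (fun t x => insertKey x t) r) := by
  induction xs generalizing l r with
  | nil => rfl
  | cons x xs ih =>
    by_cases h : x < a
    · simp [insertKey, h, ih]
    · have h' : a ≤ x := not_lt.1 h
      simp [insertKey, h, h', ih]

theorem bstShape_nil : bstShape [] = .nil := rfl

theorem bstShape_cons (a : ℝ) (xs : List ℝ) :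
    bstShape (a :: xs) =
      .node () (bstShape (xs.filter (· < a))) (bstShape (xs.filter (¬ · < a))) := by
  rw [bstShape, List.foldl_cons, insertKey, foldl_insertKey_node]
  rfl

theorem numNodes_bstShape (xs : List ℝ) : (bstShape xs).numNodes = xs.length := by
  induction h : xs.length using Nat.strong_induction_on generalizing xs with
  | _ n ih =>
    rcases xs with _ | ⟨a, xs⟩
    · simpa [bstShape_nil] using h
    · have e := List.length_eq_length_filter_add (l := xs) (fun x => decide (x < a))
      have e' : (xs.filter (¬ · < a)) = xs.filter (fun x => !decide (x < a)) :=
        List.filter_congr fun x _ => decide_not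
      rw [List.length_cons] at h
      rw [bstShape_cons, BinaryTree.numNodes, ih _ (by omega) _ rfl, ih _ (by rw [e']; omega) _ rfl,
        e']
      omega

theorem shape_bstLabeled (x : ℕ → ℝ) (n : ℕ) :
    shape (bstLabeled x n) = bstShape ((List.finRange n).map fun i : Fin n => x i) := by
  have h : bstLabeled x n = ((List.range n).map x).foldl (fun t x => insertKey x t) .nil := by
    induction n with
    | zero => rfl
    | succ n ih => rw [List.range_succ, List.map_append, List.foldl_append, ← ih]; rfl
  rw [h, bstShape, ← List.map_coe_finRange_eq_range, List.map_map]
  rfl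

section Measurability

variable {ι : Type*} [Countable ι]

theorem measurableSet_filter_lt_eq (i : ι) (xs ys : List ι) :
    MeasurableSet {v : ι → ℝ | xs.filter (fun j => v j < v i) = ys} := by
  classical
  induction xs generalizing ys with
  | nil => simp
  | cons j xs ih =>
    have hlt : MeasurableSet {v : ι → ℝ | v j < v i} :=
      measurableSet_lt (measurable_pi_apply j) (measurable_pi_apply i)
    have hcons : MeasurableSet {v : ι → ℝ | j :: xs.filter (fun j => v j < v i) = ys} := by
      rcases ys with _ | ⟨k, ys⟩
      · simp
      · by_cases hk : j = k
        · simpa [hk] using ih ys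
        · simp [hk]
    have e : {v : ι → ℝ | (j :: xs).filter (fun j => v j < v i) = ys} =
        ({v : ι → ℝ | v j < v i} ∩ {v : ι → ℝ | j :: xs.filter (fun j => v j < v i) = ys}) ∪
        ({v : ι → ℝ | v j < v i}ᶜ ∩ {v : ι → ℝ | xs.filter (fun j => v j < v i) = ys}) := by
      ext v
      by_cases h : v j < v i <;> simp [List.filter_cons, h]
    rw [e]
    exact (hlt.inter hcons).union (hlt.compl.inter (ih ys))

theorem measurableSet_filter_not_lt_eq (i : ι) (xs ys : List ι) :
    MeasurableSet {v : ι → ℝ | xs.filter (fun j => ¬ v j < v i) = ys} := by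
  classical
  induction xs generalizing ys with
  | nil => simp
  | cons j xs ih =>
    have hlt : MeasurableSet {v : ι → ℝ | v j < v i} :=
      measurableSet_lt (measurable_pi_apply j) (measurable_pi_apply i)
    have hcons : MeasurableSet {v : ι → ℝ | j :: xs.filter (fun j => ¬ v j < v i) = ys} := by
      rcases ys with _ | ⟨k, ys⟩
      · simp
      · by_cases hk : j = k
        · simpa only [hk, List.cons.injEq, true_and] using ih ys
        · simp [hk]
    have e : {v : ι → ℝ | (j :: xs).filter (fun j => ¬ v j < v i) = ys} =
        ({v : ι → ℝ | v j < v i}ᶜ ∩ {v : ι → ℝ | j :: xs.filter (fun j => ¬ v j < v i) = ys}) ∪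
        ({v : ι → ℝ | v j < v i} ∩ {v : ι → ℝ | xs.filter (fun j => ¬ v j < v i) = ys}) := by
      ext v
      by_cases h : v j < v i
      · have h' : ¬ v i ≤ v j := not_le.2 h
        simp [List.filter_cons, h, h']
      · have h' : v i ≤ v j := not_lt.1 h
        simp [List.filter_cons, h, h']
    rw [e]
    exact (hlt.compl.inter hcons).union (hlt.inter (ih ys))

/-- The event is decomposed by the lists of indices sent left and right of the root. There are only
countably many lists, and the subtree events are covered by the induction hypothesis. -/
theorem measurableSet_bstShape_eq (xs : List ι) (t : BinaryTree Unit) :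
    MeasurableSet {v : ι → ℝ | bstShape (xs.map v) = t} := by
  induction t generalizing xs with
  | nil =>
    rcases xs with _ | ⟨i, xs⟩
    · simp [bstShape_nil]
    · simp [bstShape_cons]
  | node a l r ihl ihr =>
    rcases xs with _ | ⟨i, xs⟩
    · simp [bstShape_nil]
    · have e : {v : ι → ℝ | bstShape ((i :: xs).map v) = .node a l r} =
          ⋃ ys : List ι, ⋃ zs : List ι,
            ({v : ι → ℝ | xs.filter (fun j => v j < v i) = ys} ∩
              {v : ι → ℝ | bstShape (ys.map v) = l}) ∩
            ({v : ι → ℝ | xs.filter (fun j => ¬ v j < v i) = zs} ∩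
              {v : ι → ℝ | bstShape (zs.map v) = r}) := by
        ext v
        simp only [Set.mem_iUnion, Set.mem_inter_iff, Set.mem_ofPred_eq]
        rw [List.map_cons, bstShape_cons, List.filter_map, List.filter_map,
          BinaryTree.node.injEq]
        constructor
        · rintro ⟨-, hl, hr⟩
          exact ⟨_, _, ⟨rfl, hl⟩, rfl, hr⟩
        · rintro ⟨_, _, ⟨rfl, hl⟩, rfl, hr⟩
          exact ⟨rfl, hl, hr⟩
      rw [e]
      exact .iUnion fun ys => .iUnion fun zs =>
        ((measurableSet_filter_lt_eq i xs ys).inter (ihl ys)).inter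
          ((measurableSet_filter_not_lt_eq i xs zs).inter (ihr zs))

end Measurability

/-! ### The law of the random tree -/

/-- The probability that the random tree with the size of `t` is `t`. -/
def treeProb (t : BinaryTree Unit) : ENNReal := labelLaw {ω | randomTree t.numNodes ω = t}

theorem treeProb_nil : treeProb .nil = 1 := by
  simp [treeProb, randomTree_zero]

theorem treeProb_node (l r : BinaryTree Unit) :
    treeProb (.node () l r) =
      ENNReal.ofReal (1 / ((l.numNodes + r.numNodes : ℕ) + 1)) * (treeProb l * treeProb r) := by
  have e : {ω | randomTree (l.numNodes + r.numNodes + 1) ω = .node () l r} =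
      splitLabels ⁻¹' ({u | cut (l.numNodes + r.numNodes) u = l.numNodes} ×ˢ
        ({ω | randomTree l.numNodes ω = l} ×ˢ {ω | randomTree r.numNodes ω = r})) := by
    ext ω
    exact randomTree_succ_eq_node_iff _ ω l r rfl
  rw [treeProb, BinaryTree.numNodes, e, measurePreserving_splitLabels.measure_preimage
    ((measurableSet_cut_eq _ _).prod ((measurableSet_randomTree_eq _ _).prod
      (measurableSet_randomTree_eq _ _))).nullMeasurableSet, Measure.prod_prod, Measure.prod_prod,
    unif_cut_eq (Nat.le_add_right _ _)]
  rfl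

/-! ### A beta integral -/

/-- Integration by parts moves one power from `d - u` to `u - c`; the boundary terms vanish since
both powers are positive at the ends. The binomial coefficients absorb the factor `(b + 1)/(a + 1)`.
-/
theorem integral_sub_pow_mul_sub_pow (c d : ℝ) (a b : ℕ) :
    ((a + b).choose a : ℝ) * ∫ u in c..d, (u - c) ^ a * (d - u) ^ b =
      (d - c) ^ (a + b + 1) / ((a + b : ℕ) + 1) := by
  induction b generalizing a with
  | zero =>
    have h := intervalIntegral.integral_comp_sub_right (fun u => u ^ a) (a := c) (b := d) c
    simp only [pow_zero, mul_one, add_zero, Nat.choose_self, Nat.cast_one, one_mul]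
    rw [h, integral_pow]
    simp
  | succ b ih =>
    have h := intervalIntegral.integral_mul_deriv_eq_deriv_mul (a := c) (b := d)
      (u := fun u => (d - u) ^ (b + 1)) (u' := fun u => -((b + 1 : ℕ) * (d - u) ^ b))
      (v := fun u => (u - c) ^ (a + 1) / ((a + 1 : ℕ) : ℝ)) (v' := fun u => (u - c) ^ a)
      (fun x _ => by
        have := ((hasDerivAt_id x).const_sub d).fun_pow (b + 1)
        simpa using this)
      (fun x _ => by
        have := (((hasDerivAt_id x).sub_const c).fun_pow (a + 1)).div_const ((a + 1 : ℕ) : ℝ)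
        have ha : ((a + 1 : ℕ) : ℝ) ≠ 0 := by positivity
        rwa [Nat.add_sub_cancel, mul_one, mul_div_cancel_left₀ _ ha] at this)
      (by apply Continuous.intervalIntegrable; fun_prop)
      (by apply Continuous.intervalIntegrable; fun_prop)
    have e1 : ∫ u in c..d, (u - c) ^ a * (d - u) ^ (b + 1) =
        ((b + 1 : ℕ) : ℝ) / ((a + 1 : ℕ) : ℝ) * ∫ u in c..d, (u - c) ^ (a + 1) * (d - u) ^ b := by
      rw [← intervalIntegral.integral_const_mul]
      have e2 : ∫ u in c..d, (u - c) ^ a * (d - u) ^ (b + 1) =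
          ∫ u in c..d, (d - u) ^ (b + 1) * (u - c) ^ a := by
        congr with u; ring
      rw [e2, h]
      simp only [sub_self, ne_eq, Nat.add_eq_zero_iff, one_ne_zero, and_false, not_false_eq_true,
        zero_pow, zero_mul, zero_div, mul_zero, zero_sub]
      rw [← intervalIntegral.integral_neg]
      congr with u
      ring
    have ih' := ih (a + 1)
    have e3 : a + 1 + b = a + (b + 1) := by ring
    rw [e3] at ih'
    rw [e1, ← ih', ← mul_assoc]
    congr 1
    have hc : ((a + (b + 1)).choose (a + 1) : ℝ) * ((a + 1 : ℕ) : ℝ) =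
        (a + (b + 1)).choose a * ((b + 1 : ℕ) : ℝ) := by
      have := Nat.choose_succ_right_eq (a + (b + 1)) a
      rw [Nat.add_sub_cancel_left] at this
      exact_mod_cast this
    have : ((a + 1 : ℕ) : ℝ) ≠ 0 := by positivity
    field_simp
    linarith

theorem lintegral_sub_pow_mul_sub_pow {c d : ℝ} (h : c ≤ d) (a b : ℕ) :
    ∫⁻ u in Set.Ico c d, ((a + b).choose a : ENNReal) *
        (ENNReal.ofReal ((u - c) ^ a) * ENNReal.ofReal ((d - u) ^ b)) =
      ENNReal.ofReal ((d - c) ^ (a + b + 1)) * ENNReal.ofReal (1 / ((a + b : ℕ) + 1)) := by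
  rw [← ENNReal.ofReal_mul (pow_nonneg (sub_nonneg.2 h) _), mul_one_div,
    ← integral_sub_pow_mul_sub_pow, ← intervalIntegral.integral_const_mul,
    intervalIntegral.integral_of_le h, ← integral_Ico_eq_integral_Ioc,
    ofReal_integral_eq_lintegral_ofReal]
  · refine setLIntegral_congr_fun measurableSet_Ico fun u hu => ?_
    have h1 : 0 ≤ u - c := sub_nonneg.2 hu.1
    have h2 : 0 ≤ d - u := sub_nonneg.2 hu.2.le
    rw [ENNReal.ofReal_mul (by positivity), ENNReal.ofReal_mul (by positivity),
      ENNReal.ofReal_natCast]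
  · exact (Continuous.integrableOn_Icc (by fun_prop)).mono_set Set.Ico_subset_Icc_self
  · filter_upwards [ae_restrict_mem measurableSet_Ico] with u hu
    have h1 : 0 ≤ u - c := sub_nonneg.2 hu.1
    have h2 : 0 ≤ d - u := sub_nonneg.2 hu.2.le
    simp only [Pi.zero_apply]
    positivity

/-! ### The law of the search tree of uniform keys -/

section KeyEvent

variable {ι : Type} [Fintype ι]

/-- The vectors of keys in `[c, d)` whose search tree, with the keys inserted in the order given
by `L`, has the shape `t`. -/
def keyEvent (L : List ι) (c d : ℝ) (t : BinaryTree Unit) : Set (ι → ℝ) :=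
  {v | (∀ j, v j ∈ Set.Ico c d) ∧ bstShape (L.map v) = t}

theorem measurableSet_keyEvent (L : List ι) (c d : ℝ) (t : BinaryTree Unit) :
    MeasurableSet (keyEvent L c d t) := by
  have h : MeasurableSet {v : ι → ℝ | ∀ j, v j ∈ Set.Ico c d} := by
    rw [Set.ofPred_forall]
    exact .iInter fun j => measurable_pi_apply j measurableSet_Ico
  exact h.inter (measurableSet_bstShape_eq L t)

/-- The volume of the key events of `t`, for all enumerated index types. -/
def HasKeyVolume (t : BinaryTree Unit) : Prop :=
  ∀ {ι : Type} [Fintype ι] (L : List ι), L.Nodup → (∀ i, i ∈ L) → L.length = t.numNodes →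
    ∀ {c d : ℝ}, c ≤ d → volume (keyEvent L c d t) =
      ENNReal.ofReal ((d - c) ^ t.numNodes) * treeProb t

/-- Fubini's theorem for a distinguished coordinate. -/
theorem volume_pi_eq_lintegral [DecidableEq ι] (i : ι) {s : Set (ι → ℝ)} (hs : MeasurableSet s) :
    volume s = ∫⁻ u : ℝ, volume {w : {j // ¬ j = i} → ℝ |
      (fun j => if h : j = i then u else w ⟨j, h⟩) ∈ s} := by
  let e := MeasurableEquiv.piEquivPiSubtypeProd (fun _ : ι => ℝ) (· = i)
  have he : MeasurePreserving e.symm := by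
    convert (volume_preserving_piEquivPiSubtypeProd (fun _ : ι => ℝ) (· = i)).symm e
  let f := MeasurableEquiv.funUnique {j // j = i} ℝ
  have hf : MeasurePreserving f.symm := (volume_preserving_funUnique {j // j = i} ℝ).symm f
  rw [← he.measure_preimage hs.nullMeasurableSet, Measure.volume_eq_prod,
    Measure.prod_apply (e.symm.measurable hs),
    ← hf.lintegral_comp (measurable_measure_prodMk_left (e.symm.measurable hs))]
  rfl

/-- The enumeration of a subtype induced by an enumeration. -/
def subEnum (L : List ι) (p : ι → Prop) [DecidablePred p] : List {i // p i} :=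
  (L.filter (fun i => p i)).attachWith p fun _ h => by simpa using (List.mem_filter.1 h).2

theorem nodup_subEnum {L : List ι} (hL : L.Nodup) (p : ι → Prop) [DecidablePred p] :
    (subEnum L p).Nodup := by
  apply List.Nodup.of_map Subtype.val
  rw [subEnum, List.attachWith_map_subtype_val]
  exact hL.filter _

theorem mem_subEnum {L : List ι} (hL : ∀ i, i ∈ L) (p : ι → Prop) [DecidablePred p]
    (i : {i // p i}) : i ∈ subEnum L p := by
  simp [subEnum, hL i.1, i.2]

theorem map_subEnum (L : List ι) (p : ι → Prop) [DecidablePred p] (f : ι → ℝ) :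
    (subEnum L p).map (fun i : {i // p i} => f i) = (L.filter (fun i => p i)).map f :=
  List.attachWith_map_val _

theorem length_eq_card {L : List ι} (hL : L.Nodup) (hL' : ∀ i, i ∈ L) :
    L.length = Fintype.card ι := by
  classical
  rw [← List.toFinset_card_of_nodup hL, ← Finset.card_univ]
  congr 1
  ext i
  simp [hL' i]

/-- The volume of the non-root keys, given the value of the key at the root. -/
theorem volume_split_at {l r : BinaryTree Unit} (hl : HasKeyVolume l) (hr : HasKeyVolume r)
    {L : List ι} (hL : L.Nodup) (hL' : ∀ i, i ∈ L) (hlen : L.length = l.numNodes + r.numNodes)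
    {c d u : ℝ} (hu : u ∈ Set.Ico c d) :
    volume {w : ι → ℝ | (∀ j, w j ∈ Set.Ico c d) ∧
        bstShape ((L.filter (fun j => w j < u)).map w) = l ∧
        bstShape ((L.filter (fun j => ¬ w j < u)).map w) = r} =
      ((l.numNodes + r.numNodes).choose l.numNodes : ENNReal) *
        (ENNReal.ofReal ((u - c) ^ l.numNodes) * ENNReal.ofReal ((d - u) ^ r.numNodes)) *
        (treeProb l * treeProb r) := by
  classical
  have hcard : Fintype.card ι = l.numNodes + r.numNodes := by rw [← hlen, length_eq_card hL hL']
  let e (A : Finset ι) := MeasurableEquiv.piEquivPiSubtypeProd (fun _ : ι => ℝ) (· ∈ A)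
  -- `A` is the set of indices whose keys are smaller than the root key `u`. Half-open intervals
  -- match the insertion rule exactly: smaller keys lie in `[c, u)`, the others in `[u, d)`, with no
  -- exceptional null set for ties.
  let D (A : Finset ι) : Set (ι → ℝ) := e A ⁻¹'
    (keyEvent (subEnum L (· ∈ A)) c u l ×ˢ keyEvent (subEnum L (¬ · ∈ A)) u d r)
  have mD (A : Finset ι) : MeasurableSet (D A) :=
    (e A).measurable ((measurableSet_keyEvent _ _ _ _).prod (measurableSet_keyEvent _ _ _ _))
  have hlt {A : Finset ι} {w : ι → ℝ} (hw : w ∈ D A) (j : ι) : w j < u ↔ j ∈ A := by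
    constructor
    · intro h
      by_contra hj
      exact absurd h (not_lt.2 (hw.2.1 ⟨j, hj⟩).1)
    · intro hj
      exact (hw.1.1 ⟨j, hj⟩).2
  have hmap {A : Finset ι} {w : ι → ℝ} (hA : ∀ j, w j < u ↔ j ∈ A) :
      (subEnum L (· ∈ A)).map (e A w).1 = (L.filter (fun j => w j < u)).map w ∧
      (subEnum L (¬ · ∈ A)).map (e A w).2 = (L.filter (fun j => ¬ w j < u)).map w := by
    constructor
    · refine (map_subEnum L (· ∈ A) w).trans ?_
      congr 1
      exact List.filter_congr fun j _ => by simp only [hA]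
    · refine (map_subEnum L (¬ · ∈ A) w).trans ?_
      congr 1
      exact List.filter_congr fun j _ => by simp only [hA]
  have hunion : {w : ι → ℝ | (∀ j, w j ∈ Set.Ico c d) ∧
        bstShape ((L.filter (fun j => w j < u)).map w) = l ∧
        bstShape ((L.filter (fun j => ¬ w j < u)).map w) = r} =
      ⋃ A ∈ Finset.powersetCard l.numNodes (Finset.univ : Finset ι), D A := by
    ext w
    simp only [Set.mem_iUnion, exists_prop, Finset.mem_powersetCard, Finset.subset_univ, true_and]
    constructor
    · rintro ⟨hw, hwl, hwr⟩
      have hA : ∀ j, w j < u ↔ j ∈ Finset.univ.filter (fun j => w j < u) := by simp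
      obtain ⟨h1, h2⟩ := hmap hA
      refine ⟨Finset.univ.filter (fun j => w j < u), ?_, ⟨fun j => ?_, ?_⟩, fun j => ?_, ?_⟩
      · rw [← hwl, numNodes_bstShape, ← h1, List.length_map,
          length_eq_card (nodup_subEnum hL _) (mem_subEnum hL' _), Fintype.card_coe]
      · exact ⟨(hw j).1, (hA j).2 j.2⟩
      · rw [← hwl, ← h1]
      · exact ⟨not_lt.1 fun h => j.2 ((hA j).1 h), (hw j).2⟩
      · rw [← hwr, ← h2]
    · rintro ⟨A, hA, hw⟩
      obtain ⟨h1, h2⟩ := hmap (hlt hw)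
      refine ⟨fun j => ?_, ?_, ?_⟩
      · by_cases hj : j ∈ A
        · exact ⟨(hw.1.1 ⟨j, hj⟩).1, (hw.1.1 ⟨j, hj⟩).2.trans hu.2⟩
        · exact ⟨hu.1.trans (hw.2.1 ⟨j, hj⟩).1, (hw.2.1 ⟨j, hj⟩).2⟩
      · rw [← h1]; exact hw.1.2
      · rw [← h2]; exact hw.2.2
  have hdisj : Set.PairwiseDisjoint
      ((Finset.powersetCard l.numNodes (Finset.univ : Finset ι) : Finset (Finset ι)) :
        Set (Finset ι)) D := by
    intro A _ A' _ hAA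
    refine Set.disjoint_left.2 fun w hw hw' => hAA ?_
    ext j
    rw [← hlt hw, hlt hw']
  have hvol (A : Finset ι) (hA : A ∈ Finset.powersetCard l.numNodes (Finset.univ : Finset ι)) :
      volume (D A) = (ENNReal.ofReal ((u - c) ^ l.numNodes) * treeProb l) *
        (ENNReal.ofReal ((d - u) ^ r.numNodes) * treeProb r) := by
    have hcA : A.card = l.numNodes := (Finset.mem_powersetCard.1 hA).2
    have h := volume_preserving_piEquivPiSubtypeProd (fun _ : ι => ℝ) (· ∈ A)
    have hD : volume (D A) = volume (keyEvent (subEnum L (· ∈ A)) c u l ×ˢ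
        keyEvent (subEnum L (¬ · ∈ A)) u d r) := by
      convert h.measure_preimage ((measurableSet_keyEvent _ _ _ _).prod
        (measurableSet_keyEvent _ _ _ _)).nullMeasurableSet
    rw [hD, Measure.volume_eq_prod, Measure.prod_prod,
      hl _ (nodup_subEnum hL _) (mem_subEnum hL' _) _ hu.1,
      hr _ (nodup_subEnum hL _) (mem_subEnum hL' _) _ hu.2.le]
    · rw [length_eq_card (nodup_subEnum hL _) (mem_subEnum hL' _), Fintype.card_subtype_compl,
        Fintype.card_coe, hcard, hcA, Nat.add_sub_cancel_left]
    · rw [length_eq_card (nodup_subEnum hL _) (mem_subEnum hL' _), Fintype.card_coe, hcA]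
  -- All the `D A` have the same volume, so their number, a binomial coefficient, comes out as a
  -- factor.
  rw [hunion, measure_biUnion_finset hdisj fun A _ => mD A, Finset.sum_congr rfl hvol,
    Finset.sum_const, Finset.card_powersetCard, Finset.card_univ, hcard, nsmul_eq_mul]
  ring

end KeyEvent

theorem hasKeyVolume_nil : HasKeyVolume .nil := by
  intro ι _ L hL hL' hlen c d hcd
  obtain rfl : L = [] := List.eq_nil_of_length_eq_zero hlen
  have : IsEmpty ι := ⟨fun i => by simpa using hL' i⟩
  have e : keyEvent ([] : List ι) c d .nil = Set.univ := by
    ext v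
    simp [keyEvent, bstShape_nil]
  rw [e, treeProb_nil, volume_pi, Measure.pi_of_empty]
  simp

/-- The first inserted key is the root. Fixing its value `u` leaves subtrees on smaller index types
with keys in `[c, u)` and `[u, d)`, which is why the induction hypothesis quantifies over all index
types and intervals. The beta integral over `u` then produces the factor `1 / (size of l + size of r
+ 1)` of `treeProb_node`. -/
theorem HasKeyVolume.node {l r : BinaryTree Unit} (hl : HasKeyVolume l) (hr : HasKeyVolume r) :
    HasKeyVolume (.node () l r) := by
  classical
  intro ι _ L hL hL' hlen c d hcd
  rcases L with _ | ⟨i, L⟩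
  · simp at hlen
  have hi : i ∉ L := (List.nodup_cons.1 hL).1
  have hLn : L.Nodup := (List.nodup_cons.1 hL).2
  have hne : ∀ j ∈ L, ¬ j = i := fun j hj h => hi (h ▸ hj)
  let K : List {j // ¬ j = i} := L.attachWith (fun j => ¬ j = i) hne
  have hK : K.Nodup := by
    apply List.Nodup.of_map Subtype.val
    rw [List.attachWith_map_subtype_val]
    exact hLn
  have hK' (j : {j // ¬ j = i}) : j ∈ K := by
    have := (List.mem_cons.1 (hL' j)).resolve_left j.2
    simp [K, this]
  have hKlen : K.length = l.numNodes + r.numNodes := by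
    rw [List.length_attachWith]
    simpa [BinaryTree.numNodes] using hlen
  have hset (u : ℝ) : {w : {j // ¬ j = i} → ℝ |
        (fun j => if h : j = i then u else w ⟨j, h⟩) ∈ keyEvent (i :: L) c d (.node () l r)} =
      {w | u ∈ Set.Ico c d ∧ w ∈ {w : {j // ¬ j = i} → ℝ | (∀ j, w j ∈ Set.Ico c d) ∧
        bstShape ((K.filter (fun j => w j < u)).map w) = l ∧
        bstShape ((K.filter (fun j => ¬ w j < u)).map w) = r}} := by
    ext w
    have hmap : L.map (fun j => if h : j = i then u else w ⟨j, h⟩) = K.map w := by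
      rw [← List.attachWith_map_val hne (f := fun j => if h : j = i then u else w ⟨j, h⟩)]
      exact List.map_congr_left fun j _ => dif_neg j.2
    simp only [keyEvent, Set.mem_ofPred_eq, List.map_cons, hmap]
    rw [dif_pos trivial, bstShape_cons, List.filter_map, List.filter_map, BinaryTree.node.injEq]
    constructor
    · rintro ⟨h, -, h1, h2⟩
      exact ⟨by simpa using h i, fun j => by simpa [j.2] using h j, h1, h2⟩
    · rintro ⟨hu, h, h1, h2⟩
      refine ⟨fun j => ?_, rfl, h1, h2⟩
      by_cases hj : j = i
      · rwa [dif_pos hj]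
      · rw [dif_neg hj]; exact h ⟨j, hj⟩
  have h_fiber (u : ℝ) : volume {w : {j // ¬ j = i} → ℝ |
        (fun j => if h : j = i then u else w ⟨j, h⟩) ∈ keyEvent (i :: L) c d (.node () l r)} =
      (Set.Ico c d).indicator (fun u => ((l.numNodes + r.numNodes).choose l.numNodes : ENNReal) *
        (ENNReal.ofReal ((u - c) ^ l.numNodes) * ENNReal.ofReal ((d - u) ^ r.numNodes)) *
        (treeProb l * treeProb r)) u := by
    rw [hset]
    by_cases hu : u ∈ Set.Ico c d
    · rw [Set.indicator_of_mem hu, ← volume_split_at hl hr hK hK' hKlen hu]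
      simp only [hu, true_and]
      rfl
    · rw [Set.indicator_of_notMem hu]
      simp [hu]
  rw [volume_pi_eq_lintegral i (measurableSet_keyEvent _ _ _ _), lintegral_congr h_fiber,
    lintegral_indicator measurableSet_Ico, lintegral_mul_const _ (by fun_prop),
    lintegral_sub_pow_mul_sub_pow hcd, treeProb_node, BinaryTree.numNodes, mul_assoc]

theorem hasKeyVolume (t : BinaryTree Unit) : HasKeyVolume t := by
  induction t with
  | nil => exact hasKeyVolume_nil
  | node a l r ihl ihr => exact ihl.node ihr

theorem measurable_bstShape {ι : Type} [Fintype ι] (L : List ι) :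
    Measurable fun v : ι → ℝ => bstShape (L.map v) :=
  measurable_to_countable' fun t => measurableSet_bstShape_eq L t

/-- The case `c = 0`, `d = 1` of `hasKeyVolume`; for trees with a different number of nodes both
events are empty. -/
theorem pi_unif_bstShape_eq (n : ℕ) (t : BinaryTree Unit) :
    Measure.pi (fun _ : Fin n => unif) {v | bstShape ((List.finRange n).map v) = t} =
      labelLaw {ω | randomTree n ω = t} := by
  by_cases hn : t.numNodes = n
  · have hu : unif = volume.restrict (Set.Ico (0 : ℝ) 1) := restrict_Ico_eq_restrict_Icc.symm
    have hp : Measure.pi (fun _ : Fin n => unif) =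
        (volume : Measure (Fin n → ℝ)).restrict (Set.univ.pi fun _ => Set.Ico 0 1) := by
      rw [hu, volume_pi, Measure.restrict_pi_pi]
    have e : {v : Fin n → ℝ | bstShape ((List.finRange n).map v) = t} ∩
        (Set.univ.pi fun _ => Set.Ico 0 1) = keyEvent (List.finRange n) 0 1 t := by
      ext v
      simp [keyEvent, and_comm]
    rw [hp, Measure.restrict_apply (measurableSet_bstShape_eq _ _), e,
      hasKeyVolume t _ (List.nodup_finRange n) List.mem_finRange (by simp [hn]) zero_le_one]
    simp [treeProb, hn]
  · have h1 : {v : Fin n → ℝ | bstShape ((List.finRange n).map v) = t} = ∅ := by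
      refine Set.eq_empty_of_forall_notMem fun v hv => hn ?_
      rw [← show bstShape ((List.finRange n).map v) = t from hv, numNodes_bstShape]
      simp
    have h2 : {ω | randomTree n ω = t} = ∅ := by
      refine Set.eq_empty_of_forall_notMem fun ω hω => hn ?_
      rw [← show randomTree n ω = t from hω, numNodes_randomTree]
    rw [h1, h2, measure_empty, measure_empty]

section Keys

variable {Ω : Type*} [MeasurableSpace Ω] {P : Measure Ω} {ξ : ℕ → Ω → ℝ}

theorem measurable_shape_bstLabeled (hmeas : ∀ i, Measurable (ξ i)) (n : ℕ) :
    Measurable fun ω => shape (bstLabeled (fun i => ξ i ω) n) := by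
  simp only [shape_bstLabeled]
  exact (measurable_bstShape (List.finRange n)).comp
    (measurable_pi_lambda (fun ω (i : Fin n) => ξ i ω) fun i => hmeas i)

theorem map_shape_bstLabeled [IsProbabilityMeasure P] (hmeas : ∀ i, Measurable (ξ i))
    (hindep : iIndepFun ξ P) (hunif : ∀ i, P.map (ξ i) = unif) (n : ℕ) :
    P.map (fun ω => shape (bstLabeled (fun i => ξ i ω) n)) = labelLaw.map (randomTree n) := by
  have hm : Measurable fun (ω : Ω) (i : Fin n) => ξ i ω := measurable_pi_lambda _ fun i => hmeas i
  have hpi : P.map (fun (ω : Ω) (i : Fin n) => ξ i ω) = Measure.pi fun _ : Fin n => unif := by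
    rw [(iIndepFun_iff_map_fun_eq_pi_map fun i : Fin n => (hmeas i).aemeasurable).1
      (hindep.precomp Fin.val_injective)]
    simp only [hunif]
  -- There are countably many unlabeled trees, so it suffices to compare the probabilities of single
  -- trees.
  refine Measure.ext_of_singleton fun t => ?_
  rw [Measure.map_apply (measurable_shape_bstLabeled hmeas n) (measurableSet_singleton t),
    Measure.map_apply (measurable_randomTree n) (measurableSet_singleton t)]
  refine Eq.trans ?_ (pi_unif_bstShape_eq n t)
  rw [← hpi, Measure.map_apply hm (measurableSet_bstShape_eq _ _)]
  simp only [shape_bstLabeled]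
  rfl

end Keys

end BST

end

theorem theorem8 {Ω : Type*} [MeasurableSpace Ω] (P : Measure Ω) [IsProbabilityMeasure P]
    (ξ : ℕ → Ω → ℝ) (hmeas : ∀ i, Measurable (ξ i)) (hindep : iIndepFun ξ P)
    (hunif : ∀ i, P.map (ξ i) = BST.unif) :
    Set.MapsTo BST.Psi BST.M BST.M ∧
    (∃ c : ℝ, 0 ≤ c ∧ c < 1 ∧ ∀ μ ∈ BST.M, ∀ ν ∈ BST.M,
      BST.wDist (BST.Psi μ) (BST.Psi ν) ≤ c * BST.wDist μ ν) ∧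
    ∃ μ ∈ BST.M, BST.Psi μ = μ ∧ (∀ ν ∈ BST.M, BST.Psi ν = ν → ν = μ) ∧
      TendstoInDistribution (fun (n : ℕ) (ω : Ω) => BST.pair (BST.bst (fun i => ξ i ω) n))
        atTop (id : BST.S → BST.S) (fun _ => P) (μ : Measure BST.S) := by
  have : CompleteSpace BST.C00 := BST.completeSpace_C00
  obtain ⟨Z, hZ, hfix⟩ := BST.silhouetteRec.exists_centered_lift_eq
  have hM := (BST.AffineRec.centered_iff_law_mem_M hZ.measurable).1 hZ
  have hPsi := BST.silhouetteRec.Psi_law_eq hZ.measurable hfix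
  have hF : BST.silhouetteRec.IsFunctional BST.shapePair :=
    ⟨BST.shapePair_nil, BST.shapePair_node⟩
  have hmap (n : ℕ) :
      P.map (fun ω => BST.pair (BST.bst (fun i => ξ i ω) n)) =
        BST.labelLaw.map (fun ω => BST.shapePair (BST.randomTree n ω)) := by
    have hS : Measurable BST.shapePair := measurable_from_top
    have h := BST.map_shape_bstLabeled hmeas hindep hunif n
    have h1 := Measure.map_map (μ := P) hS (BST.measurable_shape_bstLabeled hmeas n)
    have h2 := Measure.map_map (μ := BST.labelLaw) hS (BST.measurable_randomTree n)
    rw [h, h2] at h1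
    simp only [BST.bst_eq_toBinTree]
    exact h1.symm
  have hmeasZ (n : ℕ) : Measurable fun ω => BST.pair (BST.bst (fun i => ξ i ω) n) := by
    have hS : Measurable BST.shapePair := measurable_from_top
    have h := hS.comp (BST.measurable_shape_bstLabeled hmeas n)
    simp only [BST.bst_eq_toBinTree]
    exact h
  have hlim := BST.silhouetteRec.tendstoInDistribution_functional hF hZ hfix
  refine ⟨fun μ hμ => BST.silhouetteRec.Psi_mem_M hμ, ⟨9 / 10, by norm_num, by norm_num,
    fun μ hμ ν hν => BST.silhouetteRec.wDist_Psi_le hμ hν⟩,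
    BST.AffineRec.law hZ.measurable, hM, hPsi,
    fun ν hν h => BST.silhouetteRec.eq_of_Psi_eq hν hM h hPsi,
    ⟨fun n => (hmeasZ n).aemeasurable, aemeasurable_id, ?_⟩⟩
  have ht := hlim.tendsto
  -- Convergence in distribution depends only on the laws, and these coincide with the laws on the
  -- space of labels.
  simp only [hmap, Measure.map_id]
  exact ht
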